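/- Let $Q=[0,1]^2$. A Brownian sheet is a centered Gaussian process $B=(B(t))_{t\in[0,\infty)^2}$ with almost surely continuous paths and $\operatorname{Cov}(B(s),B(t))=\min(s_1,t_1)\min(s_2,t_2)$; its paths are restricted to $Q$. **Faber system.** Put $v_{-1,0}(t)=1-t$, $v_{-1,1}(t)=t$, and for $j\ge 0$, $0\le m\le 2^j-1$ let $v_{j,m}$ be the hat function of height $1$ supported on $I_{j,m}=[2^{-j}m,2^{-j}(m+1)]$, that is, linear on both halves of $I_{j,m}$, equal to $1$ at the midpoint and to $0$ outside $I_{j,m}$. Put $I_{-1,0}=I_{-1,1}=[0,1]$ and let $\chi_{j,m}$ be the characteristic function of $I_{j,m}$. For $k=(k_1,k_2)$ with integers $k_i\ge -1$, let $\mathcal P_k$ be the set of $m=(m_1,m_2)$ with $m_i\in\{0,1\}$ if $k_i=-1$ and $m_i\in\{0,\dots,2^{k_i}-1\}$ if $k_i\ge 0$, and put $v_{k,m}(t)=v_{k_1,m_1}(t_1)v_{k_2,m_2}(t_2)$, $\chi_{k,m}(t)=\chi_{k_1,m_1}(t_1)\chi_{k_2,m_2}(t_2)$. Every $f\in C(Q)$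 has a unique expansion $$f=\sum_{k\in\{-1,0,1,\dots\}^2}\ \sum_{m\in\mathcal P_k}\lambda_{k,m}\,2^{-(k_1+k_2)/2}\,v_{k,m},$$ where the partial sums over $k\in\{-1,\dots,K\}^2$ converge uniformly on $Q$ as $K\to\infty$. Put $f_j=\sum_{m\in\mathcal P_j}\lambda_{j,m}\chi_{j,m}$. **Averages.** For a function $g$ of one variable, $A_{-1}g=g$ and, for $k\ge 0$, $A_kg=\sum_{l=0}^{2^k-1}2^k\int_{I_{k,l}}g(t)\,dt\;\chi_{k,l}$. For $g$ on $Q$ and $k=(k_1,k_2)$, $A_kg$ is obtained by applying $A_{k_2}$ in the second variable and then $A_{k_1}$ in the first variable; $\widetilde A_kg=A_k(|g|)$. Let $g^*(t)=\inf\{s\ge 0: |\{r\in Q:|g(r)|>s\}|\le t\}$ be the non-increasing rearrangement. **Spaces.** For $j=(j_1,j_2)$ with $j_i\ge -1$, let $K(j)$ be the set of all $k=(k_1,k_2)$ such that, for $i=1,2$, $0\le k_i\le j_i$ if $j_i\ge 0$, and $k_i=-1$ if $j_i=-1$. For $\varepsilon>0$ put $$\|f\|_{A_\varepsilon}=\sup_{j}\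 \sup_{k\in K(j)}\ \sup_{0<t<1}\frac{2^{(j_1+j_2-(k_1+k_2))/2}}{(j_1+j_2-(k_1+k_2)+1)^{\varepsilon}}\cdot\frac{(A_kf_j)^*(t)}{\sqrt{\log(1/t)+1}},$$ $$\|f\|_{\widetilde A}=\sup_{j}\ \sup_{k\in K(j)}\ \sup_{0<t<1}\frac{(\widetilde A_kf_j)^*(t)}{\sqrt{2^{k_1+k_2-(j_1+j_2)}\log(1/t)+1}},$$ and let $A_\varepsilon(Q)$ and $\widetilde A(Q)$ be the spaces of all $f\in C(Q)$ for which the respective expression is finite. **Theorem.** Let $B$ be a Brownian sheet and $\varepsilon>0$. Then (i) $\|B(\cdot)\|_{A_\varepsilon}<\infty$ almost surely, i.e. almost every path of $B$ on $Q$ lies in $A_\varepsilon(Q)$; (ii) $\|B(\cdot)\|_{\widetilde A}<\infty$ almost surely, i.e. almost every path of $B$ on $Q$ lies in $\widetilde A(Q)$. -/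

import Mathlib

open MeasureTheory ProbabilityTheory Filter Topology Set
open scoped NNReal ENNReal

noncomputable section

namespace SheetRegularity

/-! ### The Brownian sheet -/

/-- A Brownian sheet indexed by `[0, ∞)^d`: a centered Gaussian process with covariance
`∏ i, min (s i) (t i)` and almost surely continuous paths. -/
structure IsBrownianSheet {Ω : Type*} [MeasurableSpace Ω] (d : ℕ)
    (B : (Fin d → ℝ≥0) → Ω → ℝ) (P : Measure Ω) : Prop where
  gaussian : IsGaussianProcess B P
  mean_zero : ∀ t, ∫ ω, B t ω ∂P = 0
  covariance_eq : ∀ s t, covariance (B s) (B t) P = ∏ i, ((min (s i) (t i) : ℝ≥0) : ℝ)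
  continuous_paths : ∀ᵐ ω ∂P, Continuous fun t => B t ω

/-- The unit square `Q = [0,1]²`. Functions on `Q` are represented by functions on `ℝ × ℝ` of which
only the values on `Q` are ever used. -/
def Q : Set (ℝ × ℝ) := Icc 0 1 ×ˢ Icc 0 1

/-- The path of a two-parameter process at `ω`, restricted to `Q`. -/
def pathOnQ {Ω : Type*} (B : (Fin 2 → ℝ≥0) → Ω → ℝ) (ω : Ω) : ℝ × ℝ → ℝ :=
  fun x => B ![x.1.toNNReal, x.2.toNNReal] ω

/-! ### The Faber system on `[0,1]` and on `Q`

Levels are integers `k ≥ -1`. -/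

/-- The admissible positions at level `k`: `{0, 1}` if `k = -1`, and `{0, …, 2^k - 1}` if
`k ≥ 0`. -/
def positions (k : ℤ) : Finset ℕ :=
  if k = -1 then Finset.range 2 else Finset.range (2 ^ k.toNat)

/-- The admissible positions `m = (m₁, m₂)` at the level `k = (k₁, k₂)`. -/
def positions₂ (k : ℤ × ℤ) : Finset (ℕ × ℕ) := positions k.1 ×ˢ positions k.2

/-- The univariate Faber functions: `v_{-1,0}(t) = 1 - t`, `v_{-1,1}(t) = t`, and, for `k ≥ 0`,
`v_{k,m}` is the hat function of height one on `[2^{-k} m, 2^{-k} (m + 1)]`. -/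
def faber (k : ℤ) (m : ℕ) (t : ℝ) : ℝ :=
  if k = -1 then (if m = 0 then 1 - t else t)
  else if (2 : ℝ) ^ (-k) * m ≤ t ∧ t < (2 : ℝ) ^ (-k) * m + (2 : ℝ) ^ (-k - 1) then
    (2 : ℝ) ^ (k + 1) * (t - (2 : ℝ) ^ (-k) * m)
  else if (2 : ℝ) ^ (-k) * m + (2 : ℝ) ^ (-k - 1) ≤ t ∧ t < (2 : ℝ) ^ (-k) * (m + 1) then
    (2 : ℝ) ^ (k + 1) * ((2 : ℝ) ^ (-k) * (m + 1) - t)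
  else 0

/-- The bivariate (tensor product) Faber functions. -/
def faber₂ (k : ℤ × ℤ) (m : ℕ × ℕ) (t : ℝ × ℝ) : ℝ :=
  faber k.1 m.1 t.1 * faber k.2 m.2 t.2

/-- `f = ∑_k ∑_m c k m 2^{-(k₁+k₂)/2} v_{k,m}` on `Q`, in the sense that the partial sums over
`k ∈ {-1, …, K}²` converge to `f` uniformly on `Q` as `K → ∞`. -/
def IsFaberExpansion (f : ℝ × ℝ → ℝ) (c : ℤ × ℤ → ℕ × ℕ → ℝ) : Prop :=
  TendstoUniformlyOn
    (fun (K : ℕ) (t : ℝ × ℝ) =>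
      ∑ k ∈ Finset.Icc (-1 : ℤ) (K : ℤ) ×ˢ Finset.Icc (-1 : ℤ) (K : ℤ), ∑ m ∈ positions₂ k,
        c k m * (2 : ℝ) ^ (-((k.1 : ℝ) + k.2) / 2) * faber₂ k m t)
    f atTop Q

/-! ### Step functions and averaging operators -/

/-- `I_{k,m} = [2^{-k} m, 2^{-k} (m + 1)]` for `k ≥ 0`, and `I_{-1,m} = [0,1]`. -/
def dyadicInterval (k : ℤ) (m : ℕ) : Set ℝ :=
  if k = -1 then Icc 0 1 else Icc ((2 : ℝ) ^ (-k) * m) ((2 : ℝ) ^ (-k) * (m + 1))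

/-- The characteristic function of `I_{k,m}`. -/
def chi (k : ℤ) (m : ℕ) : ℝ → ℝ := (dyadicInterval k m).indicator 1

/-- The step function `f_j = ∑_m c j m χ_{j,m}` belonging to the coefficients of level `j`. -/
def stepFun (c : ℤ × ℤ → ℕ × ℕ → ℝ) (j : ℤ × ℤ) (t : ℝ × ℝ) : ℝ :=
  ∑ m ∈ positions₂ j, c j m * (chi j.1 m.1 t.1 * chi j.2 m.2 t.2)

/-- The univariate dyadic averaging operator `A_k` for `k ≥ 0`; `A_{-1}` is the identity. -/
def avg (k : ℤ) (g : ℝ → ℝ) (x : ℝ) : ℝ :=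
  if k = -1 then g x
  else ∑ l ∈ Finset.range (2 ^ k.toNat),
    (2 : ℝ) ^ k * (∫ t in dyadicInterval k l, g t) * chi k l x

/-- The tensorized averaging operator: `A_{k₂}` in the second variable, then `A_{k₁}` in the first
variable. -/
def avg₂ (k : ℤ × ℤ) (g : ℝ × ℝ → ℝ) (x : ℝ × ℝ) : ℝ :=
  avg k.1 (fun y => avg k.2 (fun z => g (y, z)) x.2) x.1

/-- The absolute averaging operator `Ã_k g = A_k |g|`. -/
def absAvg₂ (k : ℤ × ℤ) (g : ℝ × ℝ → ℝ) : ℝ × ℝ → ℝ := avg₂ k fun x => |g x|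

/-- The non-increasing rearrangement of a function on `Q`. -/
def rearrangement (g : ℝ × ℝ → ℝ) (t : ℝ) : ℝ :=
  sInf {s : ℝ | 0 ≤ s ∧ volume {r | r ∈ Q ∧ s < |g r|} ≤ ENNReal.ofReal t}

/-! ### The function spaces -/

/-- The levels `k` of averaging used on a step function of level `j ≥ -1`, in one variable:
`0 ≤ k ≤ j` if `j ≥ 0`, and only `k = -1` if `j = -1`. -/
def AvgLevel (k j : ℤ) : Prop := (j = -1 ∧ k = -1) ∨ (0 ≤ k ∧ k ≤ j)

/-- The `A_ε`-norm in terms of the Faber coefficients. -/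
def coeffNormA (ε : ℝ) (c : ℤ × ℤ → ℕ × ℕ → ℝ) : ℝ≥0∞ :=
  ⨆ (j : ℤ × ℤ) (_ : -1 ≤ j.1 ∧ -1 ≤ j.2) (k : ℤ × ℤ)
    (_ : AvgLevel k.1 j.1 ∧ AvgLevel k.2 j.2) (t : ℝ) (_ : t ∈ Ioo (0 : ℝ) 1),
    ENNReal.ofReal
      ((2 : ℝ) ^ (((j.1 : ℝ) + j.2 - (k.1 + k.2)) / 2)
          / ((j.1 : ℝ) + j.2 - (k.1 + k.2) + 1) ^ ε
        * (rearrangement (avg₂ k (stepFun c j)) t / √(Real.log (1 / t) + 1)))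

/-- The `Ã`-norm in terms of the Faber coefficients. -/
def coeffNormAtilde (c : ℤ × ℤ → ℕ × ℕ → ℝ) : ℝ≥0∞ :=
  ⨆ (j : ℤ × ℤ) (_ : -1 ≤ j.1 ∧ -1 ≤ j.2) (k : ℤ × ℤ)
    (_ : AvgLevel k.1 j.1 ∧ AvgLevel k.2 j.2) (t : ℝ) (_ : t ∈ Ioo (0 : ℝ) 1),
    ENNReal.ofReal
      (rearrangement (absAvg₂ k (stepFun c j)) t
        / √((2 : ℝ) ^ ((k.1 : ℝ) + k.2 - (j.1 + j.2)) * Real.log (1 / t) + 1))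

/-- `‖f‖_{A_ε}`, computed from the expansion of `f` into the Faber system (the expansion is unique on
the admissible indices; the value is `∞` if there is none). -/
def normA (ε : ℝ) (f : ℝ × ℝ → ℝ) : ℝ≥0∞ :=
  ⨅ (c : ℤ × ℤ → ℕ × ℕ → ℝ) (_ : IsFaberExpansion f c), coeffNormA ε c

/-- `‖f‖_Ã`, computed from the expansion of `f` into the Faber system (the expansion is unique on
the admissible indices; the value is `∞` if there is none). -/
def normAtilde (f : ℝ × ℝ → ℝ) : ℝ≥0∞ :=
  ⨅ (c : ℤ × ℤ → ℕ × ℕ → ℝ) (_ : IsFaberExpansion f c), coeffNormAtilde c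

/-- The space `A_ε(Q)`: continuous functions on `Q` with finite `A_ε`-norm. -/
def spaceA (ε : ℝ) : Set (ℝ × ℝ → ℝ) := {f | ContinuousOn f Q ∧ normA ε f < ∞}

/-- The space `Ã(Q)`: continuous functions on `Q` with finite `Ã`-norm. -/
def spaceAtilde : Set (ℝ × ℝ → ℝ) := {f | ContinuousOn f Q ∧ normAtilde f < ∞}

end SheetRegularity

end

noncomputable section

namespace SheetRegularity

/-! ### Faber coefficients and the Faber expansion -/

/-! The Faber coefficients of a function are its tensorised second differences at dyadic points, so
at a fixed level j those of the sheet form a centred Gaussian family. Differences over distinct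
dyadic intervals are uncorrelated, so the family is independent, with variances at most 1
(`iIndepFun_faberCoeff`, `variance_faberCoeff_le`). The dependence between levels plays no role.
Both norms are infima over expansions, so it suffices to bound them for this expansion, which
converges by `isFaberExpansion_faberCoeff`.

Write N = |j| - |k|. Off a null set, A_k f_j is constant on each cell of level k, equal to 2^(-N)
times a sum of at most 4·2^N coefficients, and distinct cells use disjoint sets of coefficients. Let
y_l be the modulus of this value (for Ã: the same sum taken over the moduli) and θ = 2^N/80. If the
mean over the cells of exp(θ y_l² - p) is at most 1, Markov's inequality bounds the rearrangement at
t by √((p + log(1/t))/θ) (`rearrangement_le_of_expSqBound`). This is the required bound for p =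
(N+1)^(2ε) in the case of A_ε and p = 2^N in the case of Ã.

The condition fails with probability at most 4 exp(-3p/2)/#cells (`measure_not_expSqBound_le`):
Gaussian estimates give E exp(2θ y_l²) ≤ exp(p/2), and Chebyshev's inequality for independent cells
gains the factor 1/#cells. That factor is summable in k and the exponential in j - k, so by
Borel–Cantelli only finitely many pairs fail (`ae_finite_exceptional`), and each of them has a
finite supremum over t. -/

/-- The points whose function values enter the Faber coefficient at `(k, m)`. -/
def faberNode (k : ℤ) (m : ℕ) (i : Fin 3) : ℝ :=
  if k = -1 then (if m = 1 then 1 else 0) else (2 : ℝ) ^ (-k) * (m + (i : ℕ) / 2)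

/-- The weights of the function values in the Faber coefficient of level `k`. -/
def faberWeight (k : ℤ) : Fin 3 → ℝ :=
  -- At level -1 the three nodes coincide, and these weights evaluate once at the endpoint.
  if k = -1 then ![0, 1, 0] else ![-1 / 2, 1, -1 / 2]

/-- The univariate second difference at `(k, m)`. -/
def faberDiff (k : ℤ) (m : ℕ) (g : ℝ → ℝ) : ℝ :=
  ∑ i, faberWeight k i * g (faberNode k m i)

/-- The bivariate Faber coefficients of `f`. -/
def faberCoeff (f : ℝ × ℝ → ℝ) (k : ℤ × ℤ) (m : ℕ × ℕ) : ℝ :=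
  (2 : ℝ) ^ (((k.1 : ℝ) + k.2) / 2) *
    faberDiff k.1 m.1 fun x => faberDiff k.2 m.2 fun y => f (x, y)

/-- The partial sums of the univariate Faber expansion. -/
def faberSum (K : ℤ) (g : ℝ → ℝ) (t : ℝ) : ℝ :=
  ∑ k ∈ Finset.Icc (-1) K, ∑ m ∈ positions k, faberDiff k m g * faber k m t

lemma positions_natCast (n : ℕ) : positions (n : ℤ) = Finset.range (2 ^ n) := by
  have : (n : ℤ) ≠ -1 := by omega
  simp [positions, this]

/-- The branches agree at their common endpoints, so one formula replaces the half-open case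
distinction. -/
lemma faber_natCast (n m : ℕ) (t : ℝ) :
    faber n m t = max 0 (1 - |2 * ((2 : ℝ) ^ n * t - m) - 1|) := by
  have h1 : ((n : ℤ) = -1) = False := eq_false (by omega)
  have hp : (0 : ℝ) < 2 ^ n := by positivity
  have e1 : (2 : ℝ) ^ (-(n : ℤ)) = ((2 : ℝ) ^ n)⁻¹ := by simp
  have e2 : (2 : ℝ) ^ (-(n : ℤ) - 1) = ((2 : ℝ) ^ n)⁻¹ / 2 := by
    rw [zpow_sub₀ (by norm_num)]; simp
  have e3 : (2 : ℝ) ^ ((n : ℤ) + 1) = 2 ^ n * 2 := by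
    rw [zpow_add₀ (by norm_num)]; simp
  obtain ⟨u, rfl⟩ : ∃ u, t = ((2 : ℝ) ^ n)⁻¹ * u := ⟨2 ^ n * t, by field_simp⟩
  have hip : (0 : ℝ) < ((2 : ℝ) ^ n)⁻¹ := by positivity
  have e4 : (2 : ℝ) ^ n * (((2 : ℝ) ^ n)⁻¹ * u) = u := by field_simp
  have e5 : ((2 : ℝ) ^ n)⁻¹ * m + ((2 : ℝ) ^ n)⁻¹ / 2 = ((2 : ℝ) ^ n)⁻¹ * (m + 1 / 2) := by ring
  simp only [faber, h1, if_false, e1, e2, e3, e4, e5, mul_le_mul_iff_right₀ hip,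
    mul_lt_mul_iff_right₀ hip]
  split_ifs with h h'
  · rw [abs_of_nonpos (by linarith), max_eq_right (by linarith)]
    field_simp; ring
  · rw [abs_of_nonneg (by linarith), max_eq_right (by linarith)]
    field_simp; ring
  · rw [max_eq_left]
    rw [not_and_or, not_le, not_lt] at h h'
    rcases h with h | h
    · rw [abs_of_nonpos (by linarith)]; linarith
    · rcases h' with h' | h'
      · linarith
      · rw [abs_of_nonneg (by linarith)]; linarith

lemma faberDiff_natCast (n m : ℕ) (g : ℝ → ℝ) :
    faberDiff n m g = g ((2 * m + 1 : ℕ) / 2 ^ (n + 1)) -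
      (g ((2 * m : ℕ) / 2 ^ (n + 1)) + g ((2 * m + 2 : ℕ) / 2 ^ (n + 1))) / 2 := by
  have h1 : ((n : ℤ) = -1) = False := eq_false (by omega)
  simp only [faberDiff, faberNode, faberWeight, h1, if_false, Fin.sum_univ_three]
  have a0 : (2 : ℝ) ^ (-(n : ℤ)) * (m + (((0 : Fin 3) : ℕ) : ℝ) / 2)
      = (2 * m : ℕ) / 2 ^ (n + 1) := by
    rw [pow_succ]; simp; field_simp
  have a1 : (2 : ℝ) ^ (-(n : ℤ)) * (m + (((1 : Fin 3) : ℕ) : ℝ) / 2)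
      = (2 * m + 1 : ℕ) / 2 ^ (n + 1) := by
    rw [pow_succ]; simp; field_simp
  have a2 : (2 : ℝ) ^ (-(n : ℤ)) * (m + (((2 : Fin 3) : ℕ) : ℝ) / 2)
      = (2 * m + 2 : ℕ) / 2 ^ (n + 1) := by
    rw [pow_succ]; simp; field_simp
  rw [a0, a1, a2]
  simp
  ring

/-- The partial sums of the Faber expansion are the piecewise linear interpolations on the dyadic
grids. -/
lemma faberSum_eq (n : ℕ) (m : ℕ) (t : ℝ) (hm : m < 2 ^ n) (h0 : (m : ℝ) ≤ 2 ^ n * t)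
    (h1 : 2 ^ n * t ≤ m + 1) (g : ℝ → ℝ) :
    faberSum ((n : ℤ) - 1) g t = (1 - (2 ^ n * t - m)) * g ((m : ℕ) / 2 ^ n) +
      (2 ^ n * t - m) * g ((m + 1 : ℕ) / 2 ^ n) := by
  induction n generalizing m with
  | zero =>
    obtain rfl : m = 0 := by simpa using hm
    simp [faberSum, faberDiff, faberNode, faberWeight, faber, positions, Finset.sum_range_succ, Fin.sum_univ_three]
    ring
  | succ n ih =>
    have key : faberSum (((n + 1 : ℕ) : ℤ) - 1) g t = faberSum ((n : ℤ) - 1) g t +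
        ∑ q ∈ Finset.range (2 ^ n), faberDiff n q g * faber n q t := by
      have : Finset.Icc (-1 : ℤ) (((n + 1 : ℕ) : ℤ) - 1) =
          insert (n : ℤ) (Finset.Icc (-1 : ℤ) ((n : ℤ) - 1)) := by
        ext x; simp; omega
      rw [faberSum, this, Finset.sum_insert (by simp), positions_natCast, faberSum, add_comm]
    -- q is the interval of level n around t and r selects its half. Only the hat over q is nonzero
    -- at t; it corrects the coarser interpolation at the new midpoint.
    obtain ⟨q, r, hr, rfl⟩ : ∃ q r : ℕ, r < 2 ∧ m = 2 * q + r :=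
      ⟨m / 2, m % 2, Nat.mod_lt _ (by norm_num), by omega⟩
    have hq : q < 2 ^ n := by rw [pow_succ] at hm; omega
    rw [pow_succ] at h0 h1
    set u := (2 : ℝ) ^ n * t with hu
    have hu' : (2 : ℝ) ^ (n + 1) * t = 2 * u := by rw [pow_succ, hu]; ring
    have hu2 : (2 : ℝ) ^ n * 2 * t = 2 * u := by rw [hu]; ring
    rw [hu2] at h0 h1
    push_cast at h0 h1
    have hr1 : (r : ℝ) ≤ 1 := by exact_mod_cast Nat.lt_succ_iff.1 hr
    have hr0 : (0 : ℝ) ≤ r := by positivity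
    have hsum : ∑ q' ∈ Finset.range (2 ^ n), faberDiff n q' g * faber n q' t =
        faberDiff n q g * faber n q t := by
      refine Finset.sum_eq_single q (fun b _ hb => ?_) (fun h => absurd hq (by simpa using h))
      rw [faber_natCast, max_eq_left, mul_zero]
      rcases lt_or_gt_of_ne hb with hb | hb
      · have : (b : ℝ) + 1 ≤ q := by exact_mod_cast hb
        rw [abs_of_nonneg (by linarith)]; linarith
      · have : (q : ℝ) + 1 ≤ b := by exact_mod_cast hb
        rw [abs_of_nonpos (by linarith)]; linarith
    rw [key, hsum, ih q hq (by linarith) (by linarith), faberDiff_natCast, faber_natCast, ← hu, hu']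
    have e0 : ((q : ℕ) : ℝ) / 2 ^ n = (2 * q : ℕ) / 2 ^ (n + 1) := by
      rw [pow_succ]; push_cast; field_simp
    have e1 : ((q + 1 : ℕ) : ℝ) / 2 ^ n = (2 * q + 2 : ℕ) / 2 ^ (n + 1) := by
      rw [pow_succ]; push_cast; field_simp
    rw [e0, e1]
    interval_cases r
    · rw [abs_of_nonpos (by push_cast at h1; linarith), max_eq_right (by push_cast at h0; linarith)]
      push_cast
      simp only [add_zero]
      ring
    · rw [abs_of_nonneg (by push_cast at h0; linarith), max_eq_right (by push_cast at h1; linarith)]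
      have : 2 * q + 1 + 1 = 2 * q + 2 := by ring
      rw [this]
      push_cast
      ring

/-- A partial sum of the Faber expansion is a convex combination of two nearby values. -/
lemma exists_faberSum_eq (n : ℕ) {t : ℝ} (ht : t ∈ Icc (0 : ℝ) 1) :
    ∃ θ ∈ Icc (0 : ℝ) 1, ∃ a ∈ Icc (0 : ℝ) 1, ∃ b ∈ Icc (0 : ℝ) 1,
      |a - t| ≤ (1 / 2) ^ n ∧ |b - t| ≤ (1 / 2) ^ n ∧
      ∀ g, faberSum ((n : ℤ) - 1) g t = (1 - θ) * g a + θ * g b := by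
  have hp : (0 : ℝ) < 2 ^ n := by positivity
  obtain ⟨m, hm, h0, h1⟩ : ∃ m : ℕ, m < 2 ^ n ∧ (m : ℝ) ≤ 2 ^ n * t ∧ 2 ^ n * t ≤ m + 1 := by
    rcases eq_or_lt_of_le ht.2 with rfl | h
    -- At t = 1 the floor would give 2^n, one past the last interval.
    · refine ⟨2 ^ n - 1, Nat.sub_lt (by positivity) one_pos, ?_⟩
      rw [Nat.cast_sub Nat.one_le_two_pow]
      push_cast
      constructor <;> linarith
    · refine ⟨⌊(2 : ℝ) ^ n * t⌋₊, ?_, Nat.floor_le (mul_nonneg hp.le ht.1), (Nat.lt_floor_add_one _).le⟩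
      rw [Nat.floor_lt (mul_nonneg hp.le ht.1)]
      push_cast
      nlinarith
  have hm' : (m : ℝ) + 1 ≤ 2 ^ n := by exact_mod_cast hm
  have key : ∀ x : ℝ, |x - 2 ^ n * t| ≤ 1 → |x / 2 ^ n - t| ≤ (1 / 2) ^ n := by
    intro x hx
    have : x / 2 ^ n - t = (x - 2 ^ n * t) / 2 ^ n := by field_simp
    rw [this, abs_div, abs_of_pos hp, div_pow, one_pow]
    gcongr
  refine ⟨2 ^ n * t - m, ⟨by linarith, by linarith⟩, (m : ℕ) / 2 ^ n, ⟨by positivity, ?_⟩,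
    (m + 1 : ℕ) / 2 ^ n, ⟨by positivity, ?_⟩, key _ ?_, key _ ?_, fun g => faberSum_eq n m t hm h0 h1 g⟩
  · rw [div_le_one hp]; linarith
  · rw [div_le_one hp]; push_cast; linarith
  · rw [abs_le]; constructor <;> linarith
  · rw [abs_le]; push_cast; constructor <;> linarith

lemma faberDiff_sum {ι : Type*} (s : Finset ι) (k : ℤ) (m : ℕ) (a : ι → ℝ) (g : ι → ℝ → ℝ) :
    faberDiff k m (fun x => ∑ i ∈ s, a i * g i x) = ∑ i ∈ s, a i * faberDiff k m (g i) := by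
  simp only [faberDiff, Finset.mul_sum]
  rw [Finset.sum_comm]
  refine Finset.sum_congr rfl fun i _ => Finset.sum_congr rfl fun j _ => by ring

/-- The box of levels is a product and the powers of 2 cancel, so the partial sum is one-dimensional
interpolation in each variable in turn. -/
lemma faberCoeff_partialSum (f : ℝ × ℝ → ℝ) (K : ℤ) (t : ℝ × ℝ) :
    ∑ k ∈ Finset.Icc (-1 : ℤ) K ×ˢ Finset.Icc (-1 : ℤ) K, ∑ m ∈ positions₂ k,
      faberCoeff f k m * (2 : ℝ) ^ (-((k.1 : ℝ) + k.2) / 2) * faber₂ k m t =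
    faberSum K (fun x => faberSum K (fun y => f (x, y)) t.2) t.1 := by
  rw [Finset.sum_product]
  simp only [faberSum, positions₂]
  refine Finset.sum_congr rfl fun k₁ _ => ?_
  simp_rw [Finset.sum_product]
  rw [Finset.sum_comm]
  refine Finset.sum_congr rfl fun m₁ _ => ?_
  have h : ∀ x, ∑ k ∈ Finset.Icc (-1 : ℤ) K, ∑ m ∈ positions k,
      faberDiff k m (fun y => f (x, y)) * faber k m t.2 =
      ∑ p ∈ (Finset.Icc (-1 : ℤ) K).sigma positions,
        faber p.1 p.2 t.2 * faberDiff p.1 p.2 (fun y => f (x, y)) := by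
    intro x
    rw [Finset.sum_sigma]
    exact Finset.sum_congr rfl fun _ _ => Finset.sum_congr rfl fun _ _ => mul_comm _ _
  simp_rw [h]
  rw [faberDiff_sum _ k₁ m₁ (fun p : (_ : ℤ) × ℕ => faber p.1 p.2 t.2)
    (fun p x => faberDiff p.1 p.2 fun y => f (x, y)), Finset.sum_sigma, Finset.sum_mul]
  refine Finset.sum_congr rfl fun k₂ _ => ?_
  rw [Finset.sum_mul]
  refine Finset.sum_congr rfl fun m₂ _ => ?_
  have : (2 : ℝ) ^ (((k₁ : ℝ) + k₂) / 2) * (2 : ℝ) ^ (-((k₁ : ℝ) + k₂) / 2) = 1 := by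
    rw [← Real.rpow_add two_pos]
    ring_nf
    simp
  simp only [faberCoeff, faber₂]
  linear_combination (faberDiff k₁ m₁ fun x => faberDiff k₂ m₂ fun y => f (x, y)) *
    (faber k₁ m₁ t.1 * faber k₂ m₂ t.2) * this

/-- Every continuous function on `Q` is the uniform limit of its Faber expansion. -/
theorem isFaberExpansion_faberCoeff {f : ℝ × ℝ → ℝ} (hf : ContinuousOn f Q) :
    IsFaberExpansion f (faberCoeff f) := by
  have hQ : IsCompact Q := isCompact_Icc.prod isCompact_Icc
  have huc := hQ.uniformContinuousOn_of_continuous hf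
  rw [IsFaberExpansion, Metric.tendstoUniformlyOn_iff]
  intro e he
  obtain ⟨δ, hδ, h⟩ := Metric.uniformContinuousOn_iff.1 huc e he
  obtain ⟨K₀, hK₀⟩ := exists_pow_lt_of_lt_one hδ (by norm_num : (1 / 2 : ℝ) < 1)
  filter_upwards [eventually_ge_atTop K₀] with K hK t ht
  rw [faberCoeff_partialSum]
  have hlt : (1 / 2 : ℝ) ^ (K + 1) < δ :=
    (pow_le_pow_of_le_one (by norm_num) (by norm_num) (by omega)).trans_lt hK₀
  obtain ⟨θ₁, hθ₁, a₁, ha₁, b₁, hb₁, ha₁t, hb₁t, e₁⟩ := exists_faberSum_eq (K + 1) ht.1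
  obtain ⟨θ₂, hθ₂, a₂, ha₂, b₂, hb₂, ha₂t, hb₂t, e₂⟩ := exists_faberSum_eq (K + 1) ht.2
  have hK1 : (K : ℤ) = ((K + 1 : ℕ) : ℤ) - 1 := by push_cast; ring
  have hcl : ∀ x ∈ Icc (0 : ℝ) 1, ∀ y ∈ Icc (0 : ℝ) 1, |x - t.1| ≤ (1 / 2) ^ (K + 1) →
      |y - t.2| ≤ (1 / 2) ^ (K + 1) → |f t - f (x, y)| < e := by
    intro x hx y hy hxt hyt
    have := h t ht (x, y) ⟨hx, hy⟩ (by
      rw [dist_comm, Prod.dist_eq, max_lt_iff, Real.dist_eq, Real.dist_eq]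
      exact ⟨hxt.trans_lt hlt, hyt.trans_lt hlt⟩)
    rwa [Real.dist_eq] at this
  rw [hK1, e₁, e₂, e₂, ← Metric.mem_ball']
  -- Interpolation in both variables is an iterated convex combination of four values of f near t,
  -- all lying in one ball.
  have hconv : Convex ℝ (Metric.ball (f t) e) := convex_ball _ _
  have hmem : ∀ x ∈ Icc (0 : ℝ) 1, ∀ y ∈ Icc (0 : ℝ) 1, |x - t.1| ≤ (1 / 2) ^ (K + 1) →
      |y - t.2| ≤ (1 / 2) ^ (K + 1) → f (x, y) ∈ Metric.ball (f t) e := by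
    intro x hx y hy hxt hyt
    rw [Metric.mem_ball', Real.dist_eq]
    exact hcl x hx y hy hxt hyt
  have hcomb : ∀ θ ∈ Icc (0 : ℝ) 1, ∀ x ∈ Metric.ball (f t) e, ∀ y ∈ Metric.ball (f t) e,
      (1 - θ) * x + θ * y ∈ Metric.ball (f t) e := fun θ hθ x hx y hy =>
    hconv hx hy (by linarith [hθ.2]) hθ.1 (by ring)
  exact hcomb _ hθ₁ _ (hcomb _ hθ₂ _ (hmem _ ha₁ _ ha₂ ha₁t ha₂t) _ (hmem _ ha₁ _ hb₂ ha₁t hb₂t)) _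
    (hcomb _ hθ₂ _ (hmem _ hb₁ _ ha₂ hb₁t ha₂t) _ (hmem _ hb₁ _ hb₂ hb₁t hb₂t))

/-! ### Averages of step functions -/

/-- The index of the dyadic interval of level `k` containing the one with index `m` at level `j`. -/
def parent (k j : ℤ) (m : ℕ) : ℕ := if j = -1 then 0 else m / 2 ^ (j - k).toNat

/-- The index of the dyadic interval of level `k` containing `x`. -/
def cell (k : ℤ) (x : ℝ) : ℕ := ⌊(2 : ℝ) ^ k.toNat * x⌋₊

/-- The points that are not dyadic rationals. -/
def nonDyadic : Set ℝ := {x | ∀ n m : ℕ, (2 : ℝ) ^ n * x ≠ m}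

/-- Closed dyadic intervals share endpoints. Off this null set a point of [0,1] lies in exactly one
interval of each level, and rearrangements ignore null sets. -/
lemma ae_mem_nonDyadic : ∀ᵐ x : ℝ, x ∈ nonDyadic := by
  simp only [nonDyadic, Set.mem_ofPred_eq, ae_all_iff]
  intro n m
  have : ∀ᵐ x : ℝ, x ≠ m / 2 ^ n := by simp [ae_iff]
  filter_upwards [this] with x hx h
  exact hx (by rw [← h]; field_simp)

lemma dyadicInterval_natCast (n m : ℕ) :
    dyadicInterval n m = Icc ((m : ℝ) / 2 ^ n) ((m + 1) / 2 ^ n) := by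
  have h1 : ((n : ℤ) = -1) = False := eq_false (by omega)
  simp only [dyadicInterval, h1, if_false, zpow_neg, zpow_natCast]
  rw [inv_mul_eq_div, inv_mul_eq_div]

lemma isCompact_dyadicInterval (k : ℤ) (m : ℕ) : IsCompact (dyadicInterval k m) := by
  rw [dyadicInterval]
  split_ifs <;> exact isCompact_Icc

lemma integrable_chi (k : ℤ) (m : ℕ) : Integrable (chi k m) := by
  have h := isCompact_dyadicInterval k m
  exact (integrable_indicator_iff h.measurableSet).2 (integrableOn_const h.measure_lt_top.ne)

lemma chi_nonneg (k : ℤ) (m : ℕ) (x : ℝ) : 0 ≤ chi k m x :=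
  indicator_nonneg (fun _ _ => zero_le_one) x

lemma integral_chi (n d l m : ℕ) :
    ∫ t in dyadicInterval n l, chi ((n + d : ℕ) : ℤ) m t =
      if m / 2 ^ d = l then ((2 : ℝ) ^ (n + d))⁻¹ else 0 := by
  have hn : (0 : ℝ) < 2 ^ n := by positivity
  have hd : (0 : ℝ) < 2 ^ d := by positivity
  have hnd : (0 : ℝ) < 2 ^ (n + d) := by positivity
  rw [chi, setIntegral_indicator (isCompact_dyadicInterval _ _).measurableSet]
  simp only [Pi.one_apply, setIntegral_const, smul_eq_mul, mul_one]
  rw [dyadicInterval_natCast, dyadicInterval_natCast, Icc_inter_Icc, measureReal_def,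
    Real.volume_Icc]
  have e : ∀ y : ℝ, y / 2 ^ n = y * 2 ^ d / 2 ^ (n + d) := by
    intro y; rw [pow_add]; field_simp
  rw [e l, e (l + 1)]
  split_ifs with h
  · have h1 : l * 2 ^ d ≤ m := by rw [← h]; exact Nat.div_mul_le_self _ _
    have h2 : m + 1 ≤ (l + 1) * 2 ^ d := by
      rw [← h]
      exact Nat.lt_mul_of_div_lt (Nat.lt_succ_self _) (by positivity)
    have h1' : (l : ℝ) * 2 ^ d ≤ m := by exact_mod_cast h1
    have h2' : (m : ℝ) + 1 ≤ (l + 1) * 2 ^ d := by exact_mod_cast h2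
    rw [max_eq_right (by gcongr), min_eq_right (by gcongr), ENNReal.toReal_ofReal]
    · field_simp; ring
    · rw [sub_nonneg]; gcongr; linarith
  · rw [ENNReal.ofReal_eq_zero.2, ENNReal.toReal_zero]
    rw [sub_nonpos]
    rcases lt_or_gt_of_ne h with h | h
    · have h2 : m + 1 ≤ l * 2 ^ d := (Nat.div_lt_iff_lt_mul (by positivity)).1 h
      have h2' : (m : ℝ) + 1 ≤ l * 2 ^ d := by exact_mod_cast h2
      exact (min_le_right _ _).trans (le_trans (by gcongr) (le_max_left _ _))
    · have h2 : (l + 1) * 2 ^ d ≤ m := (Nat.le_div_iff_mul_le (by positivity)).1 h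
      have h2' : ((l : ℝ) + 1) * 2 ^ d ≤ m := by exact_mod_cast h2
      exact (min_le_left _ _).trans (le_trans (by gcongr) (le_max_right _ _))

lemma cell_lt (k : ℤ) {x : ℝ} (hx : x ∈ Icc (0 : ℝ) 1) (hx' : x ∈ nonDyadic) :
    cell k x < 2 ^ k.toNat := by
  have h1 : x ≠ 1 := by simpa using hx' 0 1
  have h2 : x < 1 := lt_of_le_of_ne hx.2 h1
  have hp : (0 : ℝ) < 2 ^ k.toNat := by positivity
  rw [cell, Nat.floor_lt (mul_nonneg hp.le hx.1)]
  push_cast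
  nlinarith

lemma chi_eq (n l : ℕ) {x : ℝ} (hx : x ∈ Icc (0 : ℝ) 1) (hx' : x ∈ nonDyadic) :
    chi n l x = if l = cell n x then 1 else 0 := by
  have hp : (0 : ℝ) < 2 ^ n := by positivity
  have hc : l = cell n x ↔ x ∈ dyadicInterval n l := by
    rw [eq_comm, cell, Int.toNat_natCast, Nat.floor_eq_iff (mul_nonneg hp.le hx.1),
      dyadicInterval_natCast, mem_Icc, div_le_iff₀' hp, le_div_iff₀' hp]
    have := hx' n (l + 1)
    push_cast at this
    exact and_congr_right fun _ => ⟨fun h => h.le, fun h => lt_of_le_of_ne h this⟩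
  by_cases h : x ∈ dyadicInterval n l
  · rw [chi, indicator_of_mem h, if_pos (hc.2 h), Pi.one_apply]
  · rw [chi, indicator_of_notMem h, if_neg fun h' => h (hc.1 h')]

lemma avg_chi {k j : ℤ} (hkj : AvgLevel k j) (m : ℕ) {x : ℝ} (hx : x ∈ Icc (0 : ℝ) 1)
    (hx' : x ∈ nonDyadic) :
    avg k (chi j m) x = if parent k j m = cell k x then ((2 : ℝ) ^ (j - k).toNat)⁻¹ else 0 := by
  rcases hkj with ⟨rfl, rfl⟩ | ⟨h0, hkj⟩
  -- At level -1 the average is the identity, the only cell is 0, and the characteristic function is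
  -- 1 on [0,1] for every position.
  · have := cell_lt (-1) hx hx'
    have h0 : cell (-1) x = 0 := by simpa using this
    simp [avg, chi, dyadicInterval, parent, h0]
    exact Set.indicator_of_mem hx _
  · obtain ⟨n, rfl⟩ := Int.eq_ofNat_of_zero_le h0
    obtain ⟨d, rfl⟩ : ∃ d : ℕ, j = ((n + d : ℕ) : ℤ) := ⟨(j - n).toNat, by omega⟩
    have h1 : ((n : ℤ) = -1) = False := eq_false (by omega)
    have h2 : (((n + d : ℕ) : ℤ) = -1) = False := eq_false (by omega)
    have h3 : (((n + d : ℕ) : ℤ) - n).toNat = d := by omega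
    have hc := cell_lt n hx hx'
    simp only [avg, parent, h1, h2, if_false, h3]
    rw [Finset.sum_eq_single (cell n x)]
    · rw [chi_eq n _ hx hx', integral_chi, if_pos rfl, mul_one, zpow_natCast]
      split_ifs
      · rw [pow_add]; field_simp
      · simp
    · intro b _ hb
      rw [chi_eq n _ hx hx', if_neg hb, mul_zero]
    · intro h
      exact absurd hc (by simpa using h)

lemma avg_sum {ι : Type*} (s : Finset ι) (k : ℤ) (a : ι → ℝ) (g : ι → ℝ → ℝ)
    (hg : ∀ i ∈ s, Integrable (g i)) (x : ℝ) :
    avg k (fun t => ∑ i ∈ s, a i * g i t) x = ∑ i ∈ s, a i * avg k (g i) x := by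
  rw [avg]
  split_ifs with hk
  · simp [avg, hk]
  · simp only [avg, hk, if_false, Finset.mul_sum]
    rw [Finset.sum_comm]
    refine Finset.sum_congr rfl fun l _ => ?_
    rw [integral_finsetSum _ fun i hi => ((hg i hi).integrableOn).const_mul _, Finset.mul_sum,
      Finset.sum_mul]
    refine Finset.sum_congr rfl fun i _ => ?_
    rw [integral_const_mul]
    ring

lemma avg_nonneg (k : ℤ) {g : ℝ → ℝ} (hg : ∀ t, 0 ≤ g t) (x : ℝ) : 0 ≤ avg k g x := by
  rw [avg]
  split_ifs
  · exact hg x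
  · exact Finset.sum_nonneg fun l _ => mul_nonneg (mul_nonneg (by positivity)
      (integral_nonneg hg)) (chi_nonneg _ _ _)

/-- Only the larger function must be integrable, since a nonintegrable one has integral 0. This
spares any measurability check for |f_j| and its inner averages. -/
lemma avg_mono (k : ℤ) {g h : ℝ → ℝ} (hg : ∀ t, 0 ≤ g t) (hgh : ∀ t, g t ≤ h t)
    (hh : Integrable h) (x : ℝ) : avg k g x ≤ avg k h x := by
  rw [avg, avg]
  split_ifs
  · exact hgh x
  · refine Finset.sum_le_sum fun l _ => ?_
    have : ∫ t in dyadicInterval k l, g t ≤ ∫ t in dyadicInterval k l, h t :=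
      integral_mono_of_nonneg (ae_of_all _ hg) hh.integrableOn (ae_of_all _ hgh)
    have := chi_nonneg k l x
    gcongr

lemma avg_stepFun_right (k : ℤ) (c : ℤ × ℤ → ℕ × ℕ → ℝ) (j : ℤ × ℤ) (y x : ℝ) :
    avg k (fun z => stepFun c j (y, z)) x =
      ∑ m ∈ positions₂ j, (c j m * avg k (chi j.2 m.2) x) * chi j.1 m.1 y := by
  have := avg_sum (positions₂ j) k (fun m => c j m * chi j.1 m.1 y) (fun m => chi j.2 m.2)
    (fun _ _ => integrable_chi _ _) x
  simp only [stepFun, ← mul_assoc]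
  rw [this]
  exact Finset.sum_congr rfl fun m _ => by ring

lemma avg₂_stepFun (k : ℤ × ℤ) (c : ℤ × ℤ → ℕ × ℕ → ℝ) (j : ℤ × ℤ) (x : ℝ × ℝ) :
    avg₂ k (stepFun c j) x =
      ∑ m ∈ positions₂ j, c j m * (avg k.1 (chi j.1 m.1) x.1 * avg k.2 (chi j.2 m.2) x.2) := by
  simp only [avg₂, avg_stepFun_right]
  rw [avg_sum _ _ _ _ fun _ _ => integrable_chi _ _]
  exact Finset.sum_congr rfl fun m _ => by ring

lemma absAvg₂_stepFun_nonneg (k : ℤ × ℤ) (c : ℤ × ℤ → ℕ × ℕ → ℝ) (j : ℤ × ℤ) (x : ℝ × ℝ) :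
    0 ≤ absAvg₂ k (stepFun c j) x :=
  avg_nonneg _ (fun _ => avg_nonneg _ (fun _ => abs_nonneg _) _) _

lemma absAvg₂_stepFun_le (k : ℤ × ℤ) (c : ℤ × ℤ → ℕ × ℕ → ℝ) (j : ℤ × ℤ) (x : ℝ × ℝ) :
    absAvg₂ k (stepFun c j) x ≤ avg₂ k (stepFun (fun j m => |c j m|) j) x := by
  refine avg_mono _ (fun _ => avg_nonneg _ (fun _ => abs_nonneg _) _) (fun y => ?_) ?_ _
  · refine avg_mono _ (fun _ => abs_nonneg _) (fun z => ?_) ?_ _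
    · refine (Finset.abs_sum_le_sum_abs _ _).trans (Finset.sum_le_sum fun m _ => ?_)
      rw [abs_mul, abs_of_nonneg (mul_nonneg (chi_nonneg _ _ _) (chi_nonneg _ _ _))]
    · refine integrable_finsetSum _ fun m _ => ?_
      exact ((integrable_chi j.2 m.2).const_mul (chi j.1 m.1 y)).const_mul |c j m|
  · simp only [avg_stepFun_right]
    exact integrable_finsetSum _ fun m _ => (integrable_chi _ _).const_mul _

/-- The positions of level `j` below the cell `l` of level `k`. -/
def children (k j : ℤ × ℤ) (l : ℕ × ℕ) : Finset (ℕ × ℕ) :=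
  {m ∈ positions₂ j | (parent k.1 j.1 m.1, parent k.2 j.2 m.2) = l}

/-- The difference of levels `|j| - |k|`. -/
def levelGap (k j : ℤ × ℤ) : ℕ := (j.1 - k.1).toNat + (j.2 - k.2).toNat

lemma avg₂_stepFun_eq {k j : ℤ × ℤ} (h : AvgLevel k.1 j.1 ∧ AvgLevel k.2 j.2)
    (c : ℤ × ℤ → ℕ × ℕ → ℝ) {x : ℝ × ℝ} (hx : x ∈ Q) (h1 : x.1 ∈ nonDyadic)
    (h2 : x.2 ∈ nonDyadic) :
    avg₂ k (stepFun c j) x =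
      ((2 : ℝ) ^ levelGap k j)⁻¹ * ∑ m ∈ children k j (cell k.1 x.1, cell k.2 x.2), c j m := by
  rw [avg₂_stepFun, children, Finset.sum_filter, Finset.mul_sum]
  refine Finset.sum_congr rfl fun m _ => ?_
  rw [avg_chi h.1 _ hx.1 h1, avg_chi h.2 _ hx.2 h2, levelGap, pow_add]
  by_cases e1 : parent k.1 j.1 m.1 = cell k.1 x.1 <;>
    by_cases e2 : parent k.2 j.2 m.2 = cell k.2 x.2 <;> simp [e1, e2, mul_comm]

/-- The factor 2 is needed only for j = -1, where positions 0 and 1 both lie over the single cell.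
-/
lemma card_filter_parent_le (k j : ℤ) (h : AvgLevel k j) (l : ℕ) :
    ({m ∈ positions j | parent k j m = l} : Finset ℕ).card ≤ 2 * 2 ^ (j - k).toNat := by
  rcases h with ⟨rfl, rfl⟩ | ⟨h0, hkj⟩
  · exact (Finset.card_filter_le _ _).trans (by simp [positions])
  · have hj : j ≠ -1 := by omega
    have : {m ∈ positions j | parent k j m = l} ⊆
        Finset.Ico (l * 2 ^ (j - k).toNat) ((l + 1) * 2 ^ (j - k).toNat) := by
      intro m hm
      simp only [parent, hj, if_false, Finset.mem_filter] at hm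
      rw [Finset.mem_Ico]
      have := hm.2
      rw [Nat.div_eq_iff (by positivity)] at this
      have hp : 0 < 2 ^ (j - k).toNat := by positivity
      rw [add_mul]
      omega
    refine (Finset.card_le_card this).trans ?_
    rw [Nat.card_Ico, add_mul, one_mul, Nat.add_sub_cancel_left]
    omega

lemma card_children_le {k j : ℤ × ℤ} (h : AvgLevel k.1 j.1 ∧ AvgLevel k.2 j.2) (l : ℕ × ℕ) :
    (children k j l).card ≤ 4 * 2 ^ levelGap k j := by
  have : children k j l = {m ∈ positions j.1 | parent k.1 j.1 m = l.1} ×ˢ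
      {m ∈ positions j.2 | parent k.2 j.2 m = l.2} := by
    ext m
    simp only [children, positions₂, Finset.mem_filter, Finset.mem_product, Prod.ext_iff]
    tauto
  rw [this, Finset.card_product]
  calc _ ≤ (2 * 2 ^ (j.1 - k.1).toNat) * (2 * 2 ^ (j.2 - k.2).toNat) :=
        Nat.mul_le_mul (card_filter_parent_le _ _ h.1 _) (card_filter_parent_le _ _ h.2 _)
    _ = _ := by rw [levelGap, pow_add]; ring

/-! ### Rearrangements of step functions and finiteness of the norms -/

/-- The dyadic cells of level `k` in `Q`. -/
def cells (k : ℤ × ℤ) : Finset (ℕ × ℕ) :=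
  Finset.range (2 ^ k.1.toNat) ×ˢ Finset.range (2 ^ k.2.toNat)

lemma card_cells (k : ℤ × ℤ) : (cells k).card = 2 ^ (k.1.toNat + k.2.toNat) := by
  simp [cells, pow_add]

lemma ae_mem_nonDyadic_prod : ∀ᵐ x : ℝ × ℝ, x.1 ∈ nonDyadic ∧ x.2 ∈ nonDyadic := by
  rw [Measure.volume_eq_prod]
  exact (Measure.quasiMeasurePreserving_fst.ae ae_mem_nonDyadic).and
    (Measure.quasiMeasurePreserving_snd.ae ae_mem_nonDyadic)

/-- Up to a null set, {|g| > s} is covered by the cells with y_l > s, and each cell has area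
1/#cells. -/
lemma rearrangement_le_of_card_le {g : ℝ × ℝ → ℝ} {k : ℤ × ℤ} {y : ℕ × ℕ → ℝ}
    (hg : ∀ x ∈ Q, x.1 ∈ nonDyadic → x.2 ∈ nonDyadic → |g x| ≤ y (cell k.1 x.1, cell k.2 x.2))
    {s t : ℝ} (hs : 0 ≤ s)
    (h : (({l ∈ cells k | s < y l} : Finset (ℕ × ℕ)).card : ℝ) ≤ t * (cells k).card) :
    rearrangement g t ≤ s := by
  refine csInf_le ⟨0, fun _ h => h.1⟩ ⟨hs, ?_⟩
  set A : Finset (ℕ × ℕ) := {l ∈ cells k | s < y l} with hA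
  set n₁ := k.1.toNat with hn₁
  set n₂ := k.2.toNat with hn₂
  have hp₁ : (0 : ℝ) < 2 ^ n₁ := by positivity
  have hp₂ : (0 : ℝ) < 2 ^ n₂ := by positivity
  let box : ℕ × ℕ → Set (ℝ × ℝ) := fun l =>
    Icc ((l.1 : ℝ) / 2 ^ n₁) ((l.1 + 1) / 2 ^ n₁) ×ˢ Icc ((l.2 : ℝ) / 2 ^ n₂) ((l.2 + 1) / 2 ^ n₂)
  have hbox : ∀ l, volume (box l) = ENNReal.ofReal ((2 ^ (n₁ + n₂))⁻¹) := by
    intro l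
    rw [Measure.volume_eq_prod, Measure.prod_prod, Real.volume_Icc, Real.volume_Icc,
      ← ENNReal.ofReal_mul (by rw [sub_nonneg]; gcongr; linarith)]
    congr 1
    rw [pow_add]
    field_simp
    ring
  have hsub : ({r | r ∈ Q ∧ s < |g r|} : Set (ℝ × ℝ)) ≤ᵐ[volume] ⋃ l ∈ A, box l := by
    filter_upwards [ae_mem_nonDyadic_prod] with x hx hxs
    obtain ⟨hxQ, hsx⟩ := hxs
    refine Set.mem_biUnion (x := (cell k.1 x.1, cell k.2 x.2)) ?_ ?_
    · simp only [hA, cells, Finset.coe_filter, Finset.mem_product, Finset.mem_range]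
      exact ⟨⟨cell_lt _ hxQ.1 hx.1, cell_lt _ hxQ.2 hx.2⟩, hsx.trans_le (hg x hxQ hx.1 hx.2)⟩
    · have key : ∀ (i : ℤ) (z : ℝ), z ∈ Icc (0 : ℝ) 1 →
          z ∈ Icc ((cell i z : ℝ) / 2 ^ i.toNat) ((cell i z + 1) / 2 ^ i.toNat) := by
        intro i z hz
        have hp : (0 : ℝ) < 2 ^ i.toNat := by positivity
        rw [mem_Icc, div_le_iff₀' hp, le_div_iff₀' hp]
        exact ⟨Nat.floor_le (mul_nonneg hp.le hz.1), (Nat.lt_floor_add_one _).le⟩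
      exact ⟨key _ _ hxQ.1, key _ _ hxQ.2⟩
  refine (measure_mono_ae hsub).trans ((measure_biUnion_finset_le _ _).trans ?_)
  simp only [hbox, Finset.sum_const, nsmul_eq_mul]
  rw [← ENNReal.ofReal_natCast, ← ENNReal.ofReal_mul (by positivity)]
  apply ENNReal.ofReal_le_ofReal
  rw [card_cells] at h
  push_cast at h
  rw [← div_eq_mul_inv, div_le_iff₀ (by positivity)]
  exact h

/-- The exponential square mean of `y` over the cells of level `k` is at most `exp p`. -/
def ExpSqBound (k : ℤ × ℤ) (θ p : ℝ) (y : ℕ × ℕ → ℝ) : Prop :=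
  ∑ l ∈ cells k, Real.exp (θ * y l ^ 2 - p) ≤ (cells k).card

/-- Markov's inequality: a cell above the threshold contributes at least 1/t to the exponential sum,
so at most a proportion t of the cells exceeds it. -/
lemma rearrangement_le_of_expSqBound {g : ℝ × ℝ → ℝ} {k : ℤ × ℤ} {y : ℕ × ℕ → ℝ}
    (hg : ∀ x ∈ Q, x.1 ∈ nonDyadic → x.2 ∈ nonDyadic → |g x| ≤ y (cell k.1 x.1, cell k.2 x.2))
    {θ p t : ℝ} (hθ : 0 < θ) (ht : t ∈ Ioo (0 : ℝ) 1) (h : ExpSqBound k θ p y) :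
    rearrangement g t ≤ √((p + Real.log (1 / t)) / θ) := by
  refine rearrangement_le_of_card_le hg (Real.sqrt_nonneg _) ?_
  set s := √((p + Real.log (1 / t)) / θ)
  set A : Finset (ℕ × ℕ) := {l ∈ cells k | s < y l} with hA
  have h1 : ∀ l ∈ A, 1 / t ≤ Real.exp (θ * y l ^ 2 - p) := by
    intro l hl
    have hsl : s < y l := (Finset.mem_filter.1 hl).2
    have h2 : (p + Real.log (1 / t)) / θ < y l ^ 2 :=
      Real.lt_sq_of_sqrt_lt hsl
    rw [div_lt_iff₀ hθ] at h2
    rw [← Real.exp_log (one_div_pos.2 ht.1)]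
    exact Real.exp_le_exp.2 (by linarith)
  have h2 : (A.card : ℝ) * (1 / t) ≤ (cells k).card :=
    calc (A.card : ℝ) * (1 / t) = ∑ l ∈ A, 1 / t := by simp
      _ ≤ ∑ l ∈ A, Real.exp (θ * y l ^ 2 - p) := Finset.sum_le_sum h1
      _ ≤ ∑ l ∈ cells k, Real.exp (θ * y l ^ 2 - p) :=
        Finset.sum_le_sum_of_subset_of_nonneg (Finset.filter_subset _ _)
          fun _ _ _ => (Real.exp_pos _).le
      _ ≤ _ := h
  rw [mul_one_div, div_le_iff₀ ht.1] at h2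
  linarith

lemma rearrangement_nonneg (g : ℝ × ℝ → ℝ) (t : ℝ) : 0 ≤ rearrangement g t :=
  Real.sInf_nonneg fun _ h => h.1

/-- The absolute value of the average of `c j` over the cell `l` of level `k`. -/
def absMean (c : ℤ × ℤ → ℕ × ℕ → ℝ) (k j : ℤ × ℤ) (l : ℕ × ℕ) : ℝ :=
  ((2 : ℝ) ^ levelGap k j)⁻¹ * |∑ m ∈ children k j l, c j m|

/-- The average of `|c j|` over the cell `l` of level `k`. -/
def meanAbs (c : ℤ × ℤ → ℕ × ℕ → ℝ) (k j : ℤ × ℤ) (l : ℕ × ℕ) : ℝ :=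
  ((2 : ℝ) ^ levelGap k j)⁻¹ * ∑ m ∈ children k j l, |c j m|

lemma abs_avg₂_stepFun_le {k j : ℤ × ℤ} (h : AvgLevel k.1 j.1 ∧ AvgLevel k.2 j.2)
    (c : ℤ × ℤ → ℕ × ℕ → ℝ) :
    ∀ x ∈ Q, x.1 ∈ nonDyadic → x.2 ∈ nonDyadic →
      |avg₂ k (stepFun c j) x| ≤ absMean c k j (cell k.1 x.1, cell k.2 x.2) := by
  intro x hx h1 h2
  rw [avg₂_stepFun_eq h c hx h1 h2, abs_mul, abs_of_pos (by positivity), absMean]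

lemma abs_absAvg₂_stepFun_le {k j : ℤ × ℤ} (h : AvgLevel k.1 j.1 ∧ AvgLevel k.2 j.2)
    (c : ℤ × ℤ → ℕ × ℕ → ℝ) :
    ∀ x ∈ Q, x.1 ∈ nonDyadic → x.2 ∈ nonDyadic →
      |absAvg₂ k (stepFun c j) x| ≤ meanAbs c k j (cell k.1 x.1, cell k.2 x.2) := by
  intro x hx h1 h2
  rw [abs_of_nonneg (absAvg₂_stepFun_nonneg _ _ _ _)]
  refine (absAvg₂_stepFun_le _ _ _ _).trans ?_
  rw [avg₂_stepFun_eq h _ hx h1 h2, meanAbs]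

lemma exists_rearrangement_le {g : ℝ × ℝ → ℝ} {k : ℤ × ℤ} {y : ℕ × ℕ → ℝ}
    (hg : ∀ x ∈ Q, x.1 ∈ nonDyadic → x.2 ∈ nonDyadic → |g x| ≤ y (cell k.1 x.1, cell k.2 x.2)) :
    ∃ M, 0 ≤ M ∧ ∀ t ∈ Ioo (0 : ℝ) 1, rearrangement g t ≤ M := by
  refine ⟨∑ l ∈ cells k, |y l|, Finset.sum_nonneg fun _ _ => abs_nonneg _, fun t ht =>
    rearrangement_le_of_card_le hg (Finset.sum_nonneg fun _ _ => abs_nonneg _) ?_⟩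
  rw [Finset.filter_false_of_mem, Finset.card_empty]
  · have := ht.1
    push_cast
    positivity
  · intro l hl
    rw [not_lt]
    exact (le_abs_self _).trans
      (Finset.single_le_sum (f := fun l => |y l|) (fun _ _ => abs_nonneg _) hl)

lemma exists_forall_le_of_finite {ι : Type*} {S : Set ι} {T : Set ℝ} {F : ι → ℝ → ℝ} {C : ℝ}
    {G : ι → Prop} (hall : ∀ i ∈ S, ∃ M, ∀ t ∈ T, F i t ≤ M)
    (hgood : ∀ i ∈ S, G i → ∀ t ∈ T, F i t ≤ C) (hfin : {i | i ∈ S ∧ ¬ G i}.Finite) :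
    ∃ M, ∀ i ∈ S, ∀ t ∈ T, F i t ≤ M := by
  choose! M hM using hall
  obtain ⟨M₀, hM₀⟩ := (hfin.image M).bddAbove
  refine ⟨max C M₀, fun i hi t ht => ?_⟩
  by_cases h : G i
  · exact (hgood i hi h t ht).trans (le_max_left _ _)
  · exact (hM i hi t ht).trans ((hM₀ (mem_image_of_mem M ⟨hi, h⟩)).trans (le_max_right _ _))

/-- The pairs `(k, j)` consisting of a level `j` and an averaging level `k` for it. -/
def admissible : Set ((ℤ × ℤ) × (ℤ × ℤ)) :=
  {i | AvgLevel i.1.1 i.2.1 ∧ AvgLevel i.1.2 i.2.2}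

lemma levelGap_cast {k j : ℤ × ℤ} (h : (k, j) ∈ admissible) :
    (j.1 : ℝ) + j.2 - (k.1 + k.2) = levelGap k j := by
  obtain ⟨h1, h2⟩ := h
  have : j.1 + j.2 - (k.1 + k.2) = ((levelGap k j : ℕ) : ℤ) := by
    simp only [AvgLevel] at h1 h2
    simp only [levelGap]
    omega
  exact_mod_cast this

/-- The constant in the exponent of the exponential square means. -/
def expScale (k j : ℤ × ℤ) : ℝ := 2 ^ levelGap k j / 80

theorem coeffNormA_lt_top {ε : ℝ} {c : ℤ × ℤ → ℕ × ℕ → ℝ}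
    (h : {i | i ∈ admissible ∧ ¬ ExpSqBound i.1 (expScale i.1 i.2)
      (((levelGap i.1 i.2 : ℝ) + 1) ^ (2 * ε)) (absMean c i.1 i.2)}.Finite) (hε : 0 < ε) :
    coeffNormA ε c < ∞ := by
  let F : (ℤ × ℤ) × (ℤ × ℤ) → ℝ → ℝ := fun i t =>
    (2 : ℝ) ^ (((i.2.1 : ℝ) + i.2.2 - (i.1.1 + i.1.2)) / 2)
      / ((i.2.1 : ℝ) + i.2.2 - (i.1.1 + i.1.2) + 1) ^ ε
      * (rearrangement (avg₂ i.1 (stepFun c i.2)) t / √(Real.log (1 / t) + 1))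
  have hlog : ∀ t ∈ Ioo (0 : ℝ) 1, 0 ≤ Real.log (1 / t) := fun t ht =>
    Real.log_nonneg (by rw [le_div_iff₀ ht.1]; linarith [ht.2])
  obtain ⟨M, hM⟩ : ∃ M, ∀ i ∈ admissible, ∀ t ∈ Ioo (0 : ℝ) 1, F i t ≤ M := by
    refine exists_forall_le_of_finite (C := √80) ?_ ?_ h
    · rintro ⟨k, j⟩ hi
      obtain ⟨M, hM0, hM⟩ := exists_rearrangement_le (abs_avg₂_stepFun_le hi c)
      refine ⟨(2 : ℝ) ^ (((j.1 : ℝ) + j.2 - (k.1 + k.2)) / 2)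
        / ((j.1 : ℝ) + j.2 - (k.1 + k.2) + 1) ^ ε * M, fun t ht => ?_⟩
      have h1 : 1 ≤ √(Real.log (1 / t) + 1) := by
        rw [Real.one_le_sqrt]; linarith [hlog t ht]
      have h2 : rearrangement (avg₂ k (stepFun c j)) t / √(Real.log (1 / t) + 1) ≤ M :=
        (div_le_self (rearrangement_nonneg _ _) h1).trans (hM t ht)
      simp only [F]
      rw [levelGap_cast hi]
      gcongr
    · rintro ⟨k, j⟩ hi hG t ht
      have hθ : 0 < expScale k j := by unfold expScale; positivity
      have hr := rearrangement_le_of_expSqBound (abs_avg₂_stepFun_le hi c) hθ ht hG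
      have hτ := hlog t ht
      simp only [F]
      rw [levelGap_cast hi]
      dsimp only at hr
      set N := levelGap k j
      set τ := Real.log (1 / t)
      have hN : (0 : ℝ) < (N : ℝ) + 1 := by positivity
      set q : ℝ := ((N : ℝ) + 1) ^ ε with hq
      have hq1 : 1 ≤ q := Real.one_le_rpow (by linarith [N.cast_nonneg (α := ℝ)]) hε.le
      have hq2 : ((N : ℝ) + 1) ^ (2 * ε) = q ^ 2 := by
        rw [mul_comm 2 ε, Real.rpow_mul hN.le, Real.rpow_two]
      have hd : (0 : ℝ) < 2 ^ ((N : ℝ) / 2) := by positivity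
      have hd2 : (2 : ℝ) ^ N = ((2 : ℝ) ^ ((N : ℝ) / 2)) ^ 2 := by
        rw [← Real.rpow_natCast, ← Real.rpow_natCast, ← Real.rpow_mul two_pos.le]
        congr 1
        push_cast
        ring
      rw [div_mul_div_comm, div_le_iff₀ (by positivity)]
      have h3 : √((((N : ℝ) + 1) ^ (2 * ε) + τ) / expScale k j) ≤
          √80 * (q * √(τ + 1)) / 2 ^ ((N : ℝ) / 2) := by
        refine Real.sqrt_le_iff.2 ⟨by positivity, ?_⟩
        have e : expScale k j = ((2 : ℝ) ^ ((N : ℝ) / 2)) ^ 2 / 80 := by rw [← hd2]; rfl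
        rw [hq2, e, div_pow, mul_pow, mul_pow, Real.sq_sqrt (by norm_num),
          Real.sq_sqrt (by linarith), div_div_eq_mul_div]
        -- Since q ≥ 1, q² + τ ≤ q²(τ + 1).
        have hq3 : 1 ≤ q ^ 2 := one_le_pow₀ hq1
        refine div_le_div_of_nonneg_right ?_ (by positivity)
        nlinarith [mul_nonneg hτ (sub_nonneg.2 hq3)]
      have h4 := hr.trans h3
      rw [le_div_iff₀ hd] at h4
      linarith
  refine lt_of_le_of_lt ?_ (ENNReal.ofReal_lt_top (r := M))
  exact iSup_le fun j => iSup_le fun _ => iSup_le fun k => iSup_le fun hk => iSup_le fun t =>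
    iSup_le fun ht => ENNReal.ofReal_le_ofReal (hM (k, j) hk t ht)

theorem coeffNormAtilde_lt_top {c : ℤ × ℤ → ℕ × ℕ → ℝ}
    (h : {i | i ∈ admissible ∧ ¬ ExpSqBound i.1 (expScale i.1 i.2)
      (2 ^ levelGap i.1 i.2) (meanAbs c i.1 i.2)}.Finite) :
    coeffNormAtilde c < ∞ := by
  let F : (ℤ × ℤ) × (ℤ × ℤ) → ℝ → ℝ := fun i t =>
    rearrangement (absAvg₂ i.1 (stepFun c i.2)) t
        / √((2 : ℝ) ^ ((i.1.1 : ℝ) + i.1.2 - (i.2.1 + i.2.2)) * Real.log (1 / t) + 1)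
  have hlog : ∀ t ∈ Ioo (0 : ℝ) 1, 0 ≤ Real.log (1 / t) := fun t ht =>
    Real.log_nonneg (by rw [le_div_iff₀ ht.1]; linarith [ht.2])
  obtain ⟨M, hM⟩ : ∃ M, ∀ i ∈ admissible, ∀ t ∈ Ioo (0 : ℝ) 1, F i t ≤ M := by
    refine exists_forall_le_of_finite (C := √80) ?_ ?_ h
    · rintro ⟨k, j⟩ hi
      obtain ⟨M, hM0, hM⟩ := exists_rearrangement_le (abs_absAvg₂_stepFun_le hi c)
      refine ⟨M, fun t ht => (div_le_self (rearrangement_nonneg _ _) ?_).trans (hM t ht)⟩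
      rw [Real.one_le_sqrt]
      have := hlog t ht
      have : 0 ≤ (2 : ℝ) ^ ((k.1 : ℝ) + k.2 - (j.1 + j.2)) * Real.log (1 / t) := by positivity
      linarith
    · rintro ⟨k, j⟩ hi hG t ht
      have hθ : 0 < expScale k j := by unfold expScale; positivity
      have hr := rearrangement_le_of_expSqBound (abs_absAvg₂_stepFun_le hi c) hθ ht hG
      have hτ := hlog t ht
      have e : (k.1 : ℝ) + k.2 - (j.1 + j.2) = -((levelGap k j : ℕ) : ℝ) := by
        rw [← levelGap_cast hi]; ring
      simp only [F]
      rw [e, Real.rpow_neg two_pos.le, Real.rpow_natCast]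
      have hp : (0 : ℝ) < 2 ^ levelGap k j := by positivity
      rw [div_le_iff₀ (by positivity), ← Real.sqrt_mul (by norm_num)]
      -- With p = 2^N the two terms p/θ = 80 and τ/θ = 80·2^(-N)τ match the denominator exactly.
      refine hr.trans (Real.sqrt_le_sqrt (le_of_eq ?_))
      simp only [expScale]
      field_simp
      ring
  refine lt_of_le_of_lt ?_ (ENNReal.ofReal_lt_top (r := M))
  exact iSup_le fun j => iSup_le fun _ => iSup_le fun k => iSup_le fun hk => iSup_le fun t =>
    iSup_le fun ht => ENNReal.ofReal_le_ofReal (hM (k, j) hk t ht)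

/-! ### Exponential square moments and Chebyshev's inequality -/

section Probability

variable {Ω : Type*} [MeasurableSpace Ω] {P : Measure Ω}

/-- The integral is (1 - v/5)^(-1/2) ≤ √(5/4) ≤ exp(1/8). Variance 0 has no density and is treated
separately. -/
lemma gaussianReal_exp_sq {v : ℝ≥0} (hv : v ≤ 1) :
    Integrable (fun x => Real.exp (x ^ 2 / 10)) (gaussianReal 0 v) ∧
      ∫ x, Real.exp (x ^ 2 / 10) ∂gaussianReal 0 v ≤ Real.exp (1 / 8) := by
  rcases eq_or_ne v 0 with rfl | hv0
  · rw [gaussianReal_zero_var]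
    exact ⟨integrable_dirac (by simp), by simp⟩
  have hvp : (0 : ℝ) < v := by exact_mod_cast pos_iff_ne_zero.2 hv0
  have hv1 : (v : ℝ) ≤ 1 := by exact_mod_cast hv
  set b : ℝ := 1 / (2 * v) - 1 / 10 with hb
  have h2b : 2 * v * b = 1 - v / 5 := by rw [hb]; field_simp; ring
  have hbp : 0 < b := by
    have : 0 < 2 * v * b := by rw [h2b]; linarith
    exact pos_of_mul_pos_right this (by positivity)
  have e : ∀ x : ℝ, gaussianPDFReal 0 v x • Real.exp (x ^ 2 / 10) =
      (√(2 * Real.pi * v))⁻¹ * Real.exp (-b * x ^ 2) := by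
    intro x
    rw [gaussianPDFReal, smul_eq_mul, mul_assoc, ← Real.exp_add, hb]
    congr 2
    field_simp
    ring
  constructor
  · rw [gaussianReal_of_var_ne_zero _ hv0, integrable_withDensity_iff_integrable_smul'
      (measurable_gaussianPDF _ _) (ae_of_all _ fun _ => gaussianPDF_lt_top)]
    simp only [toReal_gaussianPDF, e]
    exact (integrable_exp_neg_mul_sq hbp).const_mul _
  · rw [integral_gaussianReal_eq_integral_smul hv0]
    simp only [e]
    rw [integral_const_mul, integral_gaussian, inv_mul_eq_div, ← Real.sqrt_div (by positivity)]
    have e2 : Real.pi / b / (2 * Real.pi * v) = (1 - (v : ℝ) / 5)⁻¹ := by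
      rw [← h2b]; field_simp
    rw [e2, Real.sqrt_le_left (Real.exp_pos _).le, ← Real.exp_nat_mul]
    calc (1 - (v : ℝ) / 5)⁻¹ ≤ (4 / 5)⁻¹ := by gcongr; linarith
      _ ≤ 1 / 4 + 1 := by norm_num
      _ ≤ Real.exp (1 / 4) := Real.add_one_le_exp _
      _ = _ := by norm_num

lemma HasGaussianLaw.integrable_exp_sq {X : Ω → ℝ} (hX : HasGaussianLaw X P)
    (h0 : ∫ ω, X ω ∂P = 0) (hv : variance X P ≤ 1) :
    Integrable (fun ω => Real.exp (X ω ^ 2 / 10)) P ∧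
      ∫ ω, Real.exp (X ω ^ 2 / 10) ∂P ≤ Real.exp (1 / 8) := by
  have hm : ∀ μ : Measure ℝ, AEStronglyMeasurable (fun x : ℝ => Real.exp (x ^ 2 / 10)) μ :=
    fun μ => Continuous.aestronglyMeasurable (by fun_prop)
  have h := gaussianReal_exp_sq (v := (variance X P).toNNReal) (by simpa using hv)
  have hmap := hX.map_eq_gaussianReal
  rw [h0] at hmap
  rw [← hmap] at h
  exact ⟨(integrable_map_measure (hm _) hX.aemeasurable).1 h.1,
    by rw [← integral_map hX.aemeasurable (hm _)]; exact h.2⟩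

lemma integral_prod_exp_sq_le {ι : Type*} {X : ι → Ω → ℝ} (hX : iIndepFun X P)
    (hG : ∀ i, HasGaussianLaw (X i) P) (h0 : ∀ i, ∫ ω, X i ω ∂P = 0)
    (hv : ∀ i, variance (X i) P ≤ 1) (s : Finset ι) :
    Integrable (fun ω => Real.exp ((∑ i ∈ s, X i ω ^ 2) / 10)) P ∧
      ∫ ω, Real.exp ((∑ i ∈ s, X i ω ^ 2) / 10) ∂P ≤ Real.exp (s.card / 8) := by
  have hX' : iIndepFun (fun i : s => X i) P := hX.precomp Subtype.val_injective
  have hm : ∀ i : s, AEMeasurable (X i) P := fun i => (hG i).aemeasurable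
  have hf : ∀ μ : Measure ℝ, AEStronglyMeasurable (fun x : ℝ => Real.exp (x ^ 2 / 10)) μ :=
    fun μ => Continuous.aestronglyMeasurable (by fun_prop)
  have e : ∀ ω, Real.exp ((∑ i ∈ s, X i ω ^ 2) / 10) =
      ∏ i : s, (fun x : ℝ => Real.exp (x ^ 2 / 10)) (X i ω) := by
    intro ω
    rw [Finset.sum_div, Real.exp_sum, ← Finset.prod_coe_sort]
  have := hX.isProbabilityMeasure
  have hi := fun i => HasGaussianLaw.integrable_exp_sq (hG i) (h0 i) (hv i)
  simp only [e]
  constructor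
  · have hp : Integrable (fun x : s → ℝ => ∏ i, Real.exp (x i ^ 2 / 10))
        (Measure.pi fun i : s => P.map (X i)) :=
      Integrable.fintype_prod (f := fun (_ : s) (x : ℝ) => Real.exp (x ^ 2 / 10)) fun i =>
        (integrable_map_measure (hf _) (hm i)).2 (hi i).1
    rw [← hX'.map_fun_eq_pi_map hm] at hp
    exact hp.comp_aemeasurable (aemeasurable_pi_lambda _ hm)
  · rw [hX'.integral_fun_prod_comp hm fun _ => hf _]
    calc ∏ i : s, ∫ ω, Real.exp (X i ω ^ 2 / 10) ∂P ≤ ∏ _i : s, Real.exp (1 / 8) :=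
          Finset.prod_le_prod (fun _ _ => integral_nonneg fun _ => (Real.exp_pos _).le)
            fun i _ => (hi i).2
      _ = Real.exp (s.card / 8) := by
          rw [Finset.prod_const, ← Real.exp_nat_mul]
          simp
          ring

/-- Second moments at most 1/4 force means at most 1/2, so exceeding the cardinality n is a
deviation of at least n/2 from the mean. Pairwise independence bounds the variance by nV, and
Chebyshev's inequality applies. -/
lemma measure_not_sum_le [IsProbabilityMeasure P] {ι : Type*} {s : Finset ι} (hs : s.Nonempty)
    {Z : ι → Ω → ℝ} (hZ : ∀ i ∈ s, MemLp (Z i) 2 P)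
    (hind : Set.Pairwise (s : Set ι) fun i j => IndepFun (Z i) (Z j) P) {V : ℝ} (hV : V ≤ 1 / 4)
    (hZV : ∀ i ∈ s, ∫ ω, Z i ω ^ 2 ∂P ≤ V) :
    P {ω | ¬ ∑ i ∈ s, Z i ω ≤ s.card} ≤ ENNReal.ofReal (4 * V / s.card) := by
  have hn : (0 : ℝ) < s.card := by exact_mod_cast hs.card_pos
  have hvar : ∀ i ∈ s, variance (Z i) P = ∫ ω, Z i ω ^ 2 ∂P - (∫ ω, Z i ω ∂P) ^ 2 :=
    fun i hi => variance_eq_sub (hZ i hi)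
  have hmean : ∀ i ∈ s, ∫ ω, Z i ω ∂P ≤ 1 / 2 := by
    intro i hi
    have h1 := variance_nonneg (Z i) P
    rw [hvar i hi] at h1
    have h2 := hZV i hi
    nlinarith
  set S : Ω → ℝ := ∑ i ∈ s, Z i with hS
  have hSL : MemLp S 2 P := memLp_finsetSum' _ hZ
  have hSmean : ∫ ω, S ω ∂P ≤ s.card / 2 := by
    simp only [hS, Finset.sum_apply]
    rw [integral_finsetSum _ fun i hi => (hZ i hi).integrable one_le_two]
    refine (Finset.sum_le_sum hmean).trans (le_of_eq ?_)
    simp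
    ring
  have hSvar : variance S P ≤ s.card * V := by
    rw [hS, IndepFun.variance_sum hZ hind]
    refine (Finset.sum_le_sum (g := fun _ => V) fun i hi => ?_).trans (le_of_eq (by simp))
    rw [hvar i hi]
    nlinarith [hZV i hi]
  calc P {ω | ¬ ∑ i ∈ s, Z i ω ≤ s.card}
      ≤ P {ω | (s.card : ℝ) / 2 ≤ |S ω - ∫ ω, S ω ∂P|} := by
        refine measure_mono fun ω hω => ?_
        have h1 : (s.card : ℝ) < S ω := by simpa [hS] using hω
        have h2 := le_abs_self (S ω - ∫ ω, S ω ∂P)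
        change (s.card : ℝ) / 2 ≤ |S ω - ∫ ω, S ω ∂P|
        linarith
    _ ≤ ENNReal.ofReal (variance S P / (s.card / 2 : ℝ) ^ 2) :=
        meas_ge_le_variance_div_sq hSL (by positivity)
    _ ≤ _ := by
        apply ENNReal.ofReal_le_ofReal
        rw [div_le_div_iff₀ (by positivity) hn]
        nlinarith

/-- Pairwise independence of measurable functions of disjoint blocks. -/
lemma indepFun_blocks {ι : Type*} {X : ι → Ω → ℝ} (hX : iIndepFun X P)
    (hm : ∀ i, AEMeasurable (X i) P) {s t : Finset ι} (hst : Disjoint s t)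
    {φ : (s → ℝ) → ℝ} {ψ : (t → ℝ) → ℝ} (hφ : Measurable φ) (hψ : Measurable ψ) :
    IndepFun (fun ω => φ fun i => X i ω) (fun ω => ψ fun i => X i ω) P :=
  (hX.indepFun_finset₀ s t hst hm).comp hφ hψ

end Probability

/-! ### The Faber coefficients of the Brownian sheet -/

lemma faberNode_nonneg (k : ℤ) (m : ℕ) (i : Fin 3) : 0 ≤ faberNode k m i := by
  rw [faberNode]
  split_ifs <;> positivity

/-- The covariance of the second differences of a Brownian motion. -/
def diffCov (k : ℤ) (m m' : ℕ) : ℝ :=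
  ∑ i, ∑ i', faberWeight k i * faberWeight k i' * min (faberNode k m i) (faberNode k m' i')

lemma diffCov_comm (k : ℤ) (m m' : ℕ) : diffCov k m m' = diffCov k m' m := by
  rw [diffCov, diffCov, Finset.sum_comm]
  exact Finset.sum_congr rfl fun i _ => Finset.sum_congr rfl fun i' _ => by
    rw [min_comm, mul_comm (faberWeight k i')]

/-- Off level -1 every node of m lies to the left of every node of m', so the minimum depends on i
alone and the weights -1/2, 1, -1/2 of m' sum to 0. At level -1 only m = 1 has a nonzero node. -/
lemma diffCov_of_lt (k : ℤ) {m m' : ℕ} (h : m < m') : diffCov k m m' = 0 := by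
  by_cases hk : k = -1
  · subst hk
    simp only [diffCov, faberWeight, faberNode, if_true, Fin.sum_univ_three]
    have : ¬ (m = 1 ∧ m' = 1) := by omega
    by_cases h1 : m = 1 <;> by_cases h2 : m' = 1 <;> simp_all
  · have hmin : ∀ i i', min (faberNode k m i) (faberNode k m' i') = faberNode k m i := by
      intro i i'
      apply min_eq_left
      simp only [faberNode, hk, if_false]
      have h1 : (m : ℝ) + 1 ≤ m' := by exact_mod_cast h
      have h2 : ((i : ℕ) : ℝ) ≤ 2 := by exact_mod_cast Nat.lt_succ_iff.1 i.2
      have h3 : (0 : ℝ) ≤ ((i' : ℕ) : ℝ) := by positivity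
      exact mul_le_mul_of_nonneg_left (by linarith) (by positivity)
    simp only [diffCov, hmin, Fin.sum_univ_three, faberWeight, hk, if_false]
    simp
    ring

lemma diffCov_of_ne (k : ℤ) {m m' : ℕ} (h : m ≠ m') : diffCov k m m' = 0 := by
  rcases lt_or_gt_of_ne h with h | h
  · exact diffCov_of_lt k h
  · rw [diffCov_comm]; exact diffCov_of_lt k h

lemma diffCov_self (k : ℤ) (m : ℕ) :
    0 ≤ diffCov k m m ∧ (2 : ℝ) ^ k * diffCov k m m ≤ 1 := by
  by_cases hk : k = -1
  · subst hk
    simp only [diffCov, faberWeight, faberNode, if_true, Fin.sum_univ_three]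
    by_cases h1 : m = 1 <;> simp [h1]
    norm_num
  · have hp : (0 : ℝ) < 2 ^ (-k) := by positivity
    have hmul : (2 : ℝ) ^ k * 2 ^ (-k) = 1 := by
      rw [← zpow_add₀ (by norm_num)]; simp
    have e : diffCov k m m = 2 ^ (-k) / 4 := by
      have hmin : ∀ i i' : Fin 3, min (faberNode k m i) (faberNode k m i') =
          2 ^ (-k) * (m + min ((i : ℕ) / 2 : ℝ) ((i' : ℕ) / 2)) := by
        intro i i'
        simp only [faberNode, hk, if_false]
        rw [← mul_min_of_nonneg _ _ hp.le, min_add_add_left]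
      simp only [diffCov, hmin, Fin.sum_univ_three, faberWeight, hk, if_false]
      have e1 : min ((2 : ℝ)⁻¹) 1 = 2⁻¹ := by norm_num
      have e2 : min 1 ((2 : ℝ)⁻¹) = 2⁻¹ := by norm_num
      simp [e1, e2]
      ring
    rw [e]
    exact ⟨by positivity, by linarith⟩

/-- The parameters at which the sheet enters its Faber coefficient at `(k, m)`. -/
def sheetNode (k : ℤ × ℤ) (m : ℕ × ℕ) (i : Fin 3 × Fin 3) : Fin 2 → ℝ≥0 :=
  ![(faberNode k.1 m.1 i.1).toNNReal, (faberNode k.2 m.2 i.2).toNNReal]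

/-- The weight of the value of the sheet in its Faber coefficient of level `k`. -/
def sheetWeight (k : ℤ × ℤ) (i : Fin 3 × Fin 3) : ℝ :=
  (2 : ℝ) ^ (((k.1 : ℝ) + k.2) / 2) * (faberWeight k.1 i.1 * faberWeight k.2 i.2)

lemma faberCoeff_pathOnQ {Ω : Type*} {B : (Fin 2 → ℝ≥0) → Ω → ℝ} (ω : Ω) (k : ℤ × ℤ) (m : ℕ × ℕ) :
    faberCoeff (pathOnQ B ω) k m = ∑ i, sheetWeight k i * B (sheetNode k m i) ω := by
  rw [Fintype.sum_prod_type, faberCoeff, faberDiff, Finset.mul_sum]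
  refine Finset.sum_congr rfl fun i _ => ?_
  rw [faberDiff, Finset.mul_sum, Finset.mul_sum]
  refine Finset.sum_congr rfl fun i' _ => ?_
  simp only [sheetWeight, sheetNode, pathOnQ]
  ring

section Sheet

variable {Ω : Type*} [MeasurableSpace Ω] {P : Measure Ω} {B : (Fin 2 → ℝ≥0) → Ω → ℝ}

lemma isGaussianProcess_faberCoeff (hB : IsBrownianSheet 2 B P) (k : ℤ × ℤ) :
    IsGaussianProcess (fun m ω => faberCoeff (pathOnQ B ω) k m) P := by
  classical
  refine hB.gaussian.of_isGaussianProcess fun m =>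
    ⟨Finset.univ.image (sheetNode k m), ∑ i, sheetWeight k i •
      ContinuousLinearMap.proj (R := ℝ)
        ⟨sheetNode k m i, Finset.mem_image_of_mem _ (Finset.mem_univ i)⟩,
      fun ω => ?_⟩
  rw [faberCoeff_pathOnQ]
  simp

lemma integral_faberCoeff (hB : IsBrownianSheet 2 B P) (k : ℤ × ℤ) (m : ℕ × ℕ) :
    ∫ ω, faberCoeff (pathOnQ B ω) k m ∂P = 0 := by
  simp only [faberCoeff_pathOnQ]
  rw [integral_finsetSum _ fun i _ =>
    ((hB.gaussian.hasGaussianLaw_eval _).integrable).const_mul _]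
  simp [integral_const_mul, hB.mean_zero]

lemma covariance_faberCoeff (hB : IsBrownianSheet 2 B P) (k : ℤ × ℤ) (m m' : ℕ × ℕ) :
    covariance (fun ω => faberCoeff (pathOnQ B ω) k m)
      (fun ω => faberCoeff (pathOnQ B ω) k m') P =
    ((2 : ℝ) ^ k.1 * diffCov k.1 m.1 m'.1) * ((2 : ℝ) ^ k.2 * diffCov k.2 m.2 m'.2) := by
  have := hB.gaussian.isProbabilityMeasure
  have hL : ∀ t, MemLp (B t) 2 P := fun t => (hB.gaussian.hasGaussianLaw_eval t).memLp_two
  simp only [faberCoeff_pathOnQ]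
  rw [covariance_fun_sum_fun_sum (fun i => (hL _).const_mul _) (fun i => (hL _).const_mul _)]
  simp only [covariance_const_mul_left, covariance_const_mul_right, hB.covariance_eq,
    Fin.prod_univ_two, NNReal.coe_min]
  have e1 : ∀ (p : ℤ × ℤ) (q : ℕ × ℕ) i, (sheetNode p q i 0 : ℝ) = faberNode p.1 q.1 i.1 :=
    fun p q i => Real.coe_toNNReal _ (faberNode_nonneg _ _ _)
  have e2 : ∀ (p : ℤ × ℤ) (q : ℕ × ℕ) i, (sheetNode p q i 1 : ℝ) = faberNode p.2 q.2 i.2 :=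
    fun p q i => Real.coe_toNNReal _ (faberNode_nonneg _ _ _)
  have hs : (2 : ℝ) ^ (((k.1 : ℝ) + k.2) / 2) * (2 : ℝ) ^ (((k.1 : ℝ) + k.2) / 2) =
      2 ^ k.1 * 2 ^ k.2 := by
    rw [← Real.rpow_add two_pos, ← Real.rpow_intCast, ← Real.rpow_intCast, ← Real.rpow_add two_pos]
    ring_nf
  simp only [e1, e2, diffCov, Fintype.sum_prod_type, sheetWeight]
  calc _ = ((2 : ℝ) ^ (((k.1 : ℝ) + k.2) / 2) * (2 : ℝ) ^ (((k.1 : ℝ) + k.2) / 2)) *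
        ((∑ i, ∑ i', faberWeight k.1 i * faberWeight k.1 i' *
          min (faberNode k.1 m.1 i) (faberNode k.1 m'.1 i')) *
        (∑ i, ∑ i', faberWeight k.2 i * faberWeight k.2 i' *
          min (faberNode k.2 m.2 i) (faberNode k.2 m'.2 i'))) := by
        simp only [Finset.sum_mul_sum]
        simp only [Finset.mul_sum]
        refine Finset.sum_congr rfl fun i _ => Finset.sum_congr rfl fun j _ =>
          Finset.sum_congr rfl fun i' _ => Finset.sum_congr rfl fun j' _ => by ring
    _ = _ := by rw [hs]; ring

/-- Uncorrelated members of a Gaussian process are independent. All of ℕ × ℕ may serve as index set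
because the sheet is also defined outside Q. -/
lemma iIndepFun_faberCoeff (hB : IsBrownianSheet 2 B P) (k : ℤ × ℤ) :
    iIndepFun (fun m ω => faberCoeff (pathOnQ B ω) k m) P := by
  have hG := isGaussianProcess_faberCoeff hB k
  -- The criterion concerns families of processes, so each coefficient is viewed as a process over a
  -- one-point set.
  have h := IsGaussianProcess.iIndepFun_of_covariance_eq_zero (S := fun _ : ℕ × ℕ => Unit)
    (X := fun m _ ω => faberCoeff (pathOnQ B ω) k m) (hG.comp_right Sigma.fst)
    (fun m _ => hG.aemeasurable m) (fun m m' hm _ _ => by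
      rw [covariance_faberCoeff hB]
      rcases Prod.ext_iff.not.1 hm |> not_and_or.1 with h | h
      · rw [diffCov_of_ne _ h]; ring
      · rw [diffCov_of_ne _ h]; ring)
  exact h.comp (fun _ g => g ()) fun _ => measurable_pi_apply _

lemma variance_faberCoeff_le (hB : IsBrownianSheet 2 B P) (k : ℤ × ℤ) (m : ℕ × ℕ) :
    variance (fun ω => faberCoeff (pathOnQ B ω) k m) P ≤ 1 := by
  rw [← covariance_self ((isGaussianProcess_faberCoeff hB k).aemeasurable m),
    covariance_faberCoeff hB]
  have h1 := diffCov_self k.1 m.1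
  have h2 := diffCov_self k.2 m.2
  exact mul_le_one₀ h1.2 (mul_nonneg (by positivity) h2.1) h2.2

end Sheet

/-! ### Probabilities of the exceptional events -/

section Exceptional

variable {Ω : Type*} [MeasurableSpace Ω] {P : Measure Ω} {X : ℕ × ℕ → Ω → ℝ}

lemma exp_neg_le_quarter {p : ℝ} (hp : 1 ≤ p) : Real.exp (-(3 / 2 * p)) ≤ 1 / 4 := by
  have h1 : (4 : ℝ) ≤ Real.exp (3 / 2) := by
    have e1 := Real.exp_one_gt_d9
    have e2 := Real.quadratic_le_exp_of_nonneg (x := 1 / 2) (by norm_num)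
    have : Real.exp (3 / 2) = Real.exp 1 * Real.exp (1 / 2) := by
      rw [← Real.exp_add]; norm_num
    rw [this]
    nlinarith
  rw [Real.exp_neg, one_div]
  gcongr
  exact h1.trans (Real.exp_le_exp.2 (by linarith))

lemma disjoint_children (k j : ℤ × ℤ) {l l' : ℕ × ℕ} (h : l ≠ l') :
    Disjoint (children k j l) (children k j l') :=
  Finset.disjoint_filter.2 fun _ _ h1 h2 => h (h1.symm.trans h2)

lemma cells_nonempty (k : ℤ × ℤ) : (cells k).Nonempty := by
  rw [← Finset.card_pos, card_cells]
  positivity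

/-- The squared summand exp(2θφ² - 2p) has mean at most exp(p/2 - 2p), the V of
`measure_not_sum_le`. Distinct cells are independent because their children are disjoint. Keeping φ
general serves both norms. -/
lemma measure_not_expSqBound_le [IsProbabilityMeasure P] (hX : iIndepFun X P)
    (hm : ∀ i, AEMeasurable (X i) P) (k j : ℤ × ℤ)
    {φ : (l : ℕ × ℕ) → (children k j l → ℝ) → ℝ} (hφ : ∀ l, Measurable (φ l)) {θ p : ℝ}
    (hp : 1 ≤ p)
    (hint : ∀ l, Integrable (fun ω => Real.exp (2 * (θ * φ l (fun i => X i ω) ^ 2))) P ∧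
      ∫ ω, Real.exp (2 * (θ * φ l (fun i => X i ω) ^ 2)) ∂P ≤ Real.exp (p / 2)) :
    P {ω | ¬ ExpSqBound k θ p fun l => φ l fun i => X i ω} ≤
      ENNReal.ofReal (4 * Real.exp (-(3 / 2 * p)) / (cells k).card) := by
  have hmeas : ∀ l, Measurable fun v : children k j l → ℝ => Real.exp (θ * φ l v ^ 2 - p) := by
    intro l
    have := hφ l
    fun_prop
  have hsq : ∀ l ω, Real.exp (θ * φ l (fun i => X i ω) ^ 2 - p) ^ 2 =
      Real.exp (2 * (θ * φ l (fun i => X i ω) ^ 2)) * Real.exp (-(2 * p)) := by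
    intro l ω
    rw [← Real.exp_nat_mul, ← Real.exp_add]
    congr 1
    push_cast
    ring
  refine measure_not_sum_le (cells_nonempty k)
    (Z := fun l ω => Real.exp (θ * φ l (fun i => X i ω) ^ 2 - p)) (fun l _ => ?_)
    (fun l _ l' _ hl => ?_) (exp_neg_le_quarter hp) fun l _ => ?_
  · have hae : AEMeasurable (fun ω => Real.exp (θ * φ l (fun i => X i ω) ^ 2 - p)) P :=
      (hmeas l).comp_aemeasurable (aemeasurable_pi_lambda _ fun i => hm i)
    rw [memLp_two_iff_integrable_sq hae.aestronglyMeasurable]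
    simp only [hsq]
    exact (hint l).1.mul_const _
  · exact indepFun_blocks hX hm (disjoint_children k j hl) (hmeas l) (hmeas l')
  · simp only [hsq]
    rw [integral_mul_const]
    refine (mul_le_mul_of_nonneg_right (hint l).2 (Real.exp_pos _).le).trans (le_of_eq ?_)
    rw [← Real.exp_add]
    congr 1
    ring

/-- Divided by √(4·2^N), the sum is Gaussian with variance at most 1, and the exponent is its square
over 10; hence the 80. -/
lemma integral_exp_sq_absMean_le [IsProbabilityMeasure P] (hX : iIndepFun X P)
    (hG : ∀ i, HasGaussianLaw (X i) P) (h0 : ∀ i, ∫ ω, X i ω ∂P = 0)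
    (hv : ∀ i, variance (X i) P ≤ 1) {s : Finset (ℕ × ℕ)} {N : ℕ} (hs : s.card ≤ 4 * 2 ^ N) :
    Integrable (fun ω => Real.exp
        (2 * (2 ^ N / 80 * (((2 : ℝ) ^ N)⁻¹ * |∑ i : s, X i ω|) ^ 2))) P ∧
      ∫ ω, Real.exp (2 * (2 ^ N / 80 * (((2 : ℝ) ^ N)⁻¹ * |∑ i : s, X i ω|) ^ 2)) ∂P ≤
        Real.exp (1 / 8) := by
  have hp : (0 : ℝ) < 2 ^ N := by positivity
  set a : ℝ := (√(4 * 2 ^ N))⁻¹ with ha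
  have ha2 : a ^ 2 = (4 * 2 ^ N)⁻¹ := by rw [ha, inv_pow, Real.sq_sqrt (by positivity)]
  have hXs : iIndepFun (fun i : s => X i) P := hX.precomp Subtype.val_injective
  have hS : HasGaussianLaw (fun ω => ∑ i : s, X i ω) P :=
    iIndepFun.hasGaussianLaw_fun_sum (fun i : s => hG i) hXs
  have hY : HasGaussianLaw (fun ω => a * ∑ i : s, X i ω) P := hS.fun_smul a
  have hY0 : ∫ ω, a * ∑ i : s, X i ω ∂P = 0 := by
    rw [integral_const_mul,
      integral_finsetSum _ (f := fun (i : s) ω => X i ω) fun i _ => (hG i).integrable]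
    simp [h0]
  have hSv : variance (fun ω => ∑ i : s, X i ω) P ≤ 4 * 2 ^ N := by
    have e : (fun ω => ∑ i : s, X i ω) = ∑ i : s, X i := by ext; simp
    rw [e, IndepFun.variance_sum (X := fun i : s => X i) (fun i _ => (hG i).memLp_two)
      fun i _ i' _ hi => hXs.indepFun hi]
    calc ∑ i : s, variance (X i) P ≤ ∑ _i : s, (1 : ℝ) := Finset.sum_le_sum fun i _ => hv i
      _ = s.card := by simp
      _ ≤ _ := by exact_mod_cast hs
  have hYv : variance (fun ω => a * ∑ i : s, X i ω) P ≤ 1 := by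
    rw [variance_const_mul, ha2, inv_mul_le_iff₀ (by positivity)]
    linarith
  have key := HasGaussianLaw.integrable_exp_sq hY hY0 hYv
  have e : ∀ ω, 2 * (2 ^ N / 80 * (((2 : ℝ) ^ N)⁻¹ * |∑ i : s, X i ω|) ^ 2) =
      (a * ∑ i : s, X i ω) ^ 2 / 10 := by
    intro ω
    rw [mul_pow, sq_abs, mul_pow, ha2]
    field_simp
    ring
  simp only [e]
  exact key

/-- Moduli do not cancel, so Cauchy–Schwarz bounds the exponent by ∑ X_i²/10. Independence then
gives exp(card/8) ≤ exp(2^N/2), which dictates p = 2^N. -/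
lemma integral_exp_sq_meanAbs_le [IsProbabilityMeasure P] (hX : iIndepFun X P)
    (hG : ∀ i, HasGaussianLaw (X i) P) (h0 : ∀ i, ∫ ω, X i ω ∂P = 0)
    (hv : ∀ i, variance (X i) P ≤ 1) {s : Finset (ℕ × ℕ)} {N : ℕ} (hs : s.card ≤ 4 * 2 ^ N) :
    Integrable (fun ω => Real.exp
        (2 * (2 ^ N / 80 * (((2 : ℝ) ^ N)⁻¹ * ∑ i : s, |X i ω|) ^ 2))) P ∧
      ∫ ω, Real.exp (2 * (2 ^ N / 80 * (((2 : ℝ) ^ N)⁻¹ * ∑ i : s, |X i ω|) ^ 2)) ∂P ≤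
        Real.exp (2 ^ N / 2) := by
  have hp : (0 : ℝ) < 2 ^ N := by positivity
  have hs' : (s.card : ℝ) ≤ 4 * 2 ^ N := by exact_mod_cast hs
  obtain ⟨hi, hle⟩ := integral_prod_exp_sq_le hX hG h0 hv s
  have hbd : ∀ ω, Real.exp (2 * (2 ^ N / 80 * (((2 : ℝ) ^ N)⁻¹ * ∑ i : s, |X i ω|) ^ 2)) ≤
      Real.exp ((∑ i ∈ s, X i ω ^ 2) / 10) := by
    intro ω
    apply Real.exp_le_exp.2
    have h1 : (∑ i : s, |X i ω|) ^ 2 ≤ 4 * 2 ^ N * ∑ i ∈ s, X i ω ^ 2 := by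
      have := sq_sum_le_card_mul_sum_sq (s := s) (f := fun i => |X i ω|)
      simp only [sq_abs] at this
      rw [← Finset.sum_coe_sort s fun i => |X i ω|] at this
      refine this.trans (mul_le_mul_of_nonneg_right hs' (Finset.sum_nonneg fun _ _ => sq_nonneg _))
    calc 2 * (2 ^ N / 80 * (((2 : ℝ) ^ N)⁻¹ * ∑ i : s, |X i ω|) ^ 2)
        = (∑ i : s, |X i ω|) ^ 2 / (40 * 2 ^ N) := by field_simp; ring
      _ ≤ (4 * 2 ^ N * ∑ i ∈ s, X i ω ^ 2) / (40 * 2 ^ N) := by gcongr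
      _ = _ := by field_simp; ring
  have hm : ∀ i, AEMeasurable (X i) P := fun i => (hG i).aemeasurable
  have hint : Integrable (fun ω => Real.exp
      (2 * (2 ^ N / 80 * (((2 : ℝ) ^ N)⁻¹ * ∑ i : s, |X i ω|) ^ 2))) P := by
    refine hi.mono' ?_ (ae_of_all _ fun ω => ?_)
    · refine AEMeasurable.aestronglyMeasurable ?_
      have : AEMeasurable (fun ω => ∑ i : s, |X i ω|) P :=
        Finset.aemeasurable_fun_sum _ fun i _ => (hm i).abs
      fun_prop
    · rw [Real.norm_eq_abs, Real.abs_exp]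
      exact hbd ω
  refine ⟨hint, (integral_mono hint hi hbd).trans (hle.trans (Real.exp_le_exp.2 ?_))⟩
  linarith

end Exceptional

/-! ### Borel–Cantelli over all pairs of levels -/

/-- The parametrization of the pairs of levels by natural numbers. -/
def levelPair (n : (ℕ × ℕ) × (ℕ × ℕ)) : (ℤ × ℤ) × (ℤ × ℤ) :=
  (((n.1.1 : ℤ) - 1, (n.1.2 : ℤ) - 1),
    ((n.1.1 : ℤ) - 1 + n.2.1, (n.1.2 : ℤ) - 1 + n.2.2))

lemma exists_levelPair_eq {i : (ℤ × ℤ) × (ℤ × ℤ)} (hi : i ∈ admissible) :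
    ∃ n, levelPair n = i := by
  obtain ⟨⟨k₁, k₂⟩, j₁, j₂⟩ := i
  obtain ⟨h1, h2⟩ := hi
  simp only [AvgLevel] at h1 h2
  refine ⟨(((k₁ + 1).toNat, (k₂ + 1).toNat), ((j₁ - k₁).toNat, (j₂ - k₂).toNat)), ?_⟩
  simp only [levelPair, Prod.mk.injEq]
  omega

lemma levelGap_levelPair (n : (ℕ × ℕ) × (ℕ × ℕ)) :
    levelGap (levelPair n).1 (levelPair n).2 = n.2.1 + n.2.2 := by
  simp only [levelGap, levelPair]
  omega

/-- Exponential decay in x beats x^(-2/δ); at x = N^δ this is a comparison with N^(-2). -/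
lemma summable_exp_neg_rpow {δ : ℝ} (hδ : 0 < δ) :
    Summable fun N : ℕ => Real.exp (-(1 / 2) * ((N : ℝ) + 1) ^ δ) := by
  have h1 := (isLittleO_exp_neg_mul_rpow_atTop (a := 1 / 2) (by norm_num) (-2 / δ)).comp_tendsto
    (tendsto_rpow_atTop hδ)
  have h2 : Summable fun N : ℕ => Real.exp (-(1 / 2) * (N : ℝ) ^ δ) := by
    refine summable_of_isBigO_nat (g := fun N : ℕ => (N : ℝ) ^ (-2 : ℝ))
      (Real.summable_nat_rpow.2 (by norm_num)) ?_
    refine (h1.comp_tendsto tendsto_natCast_atTop_atTop).isBigO.congr (fun _ => rfl) fun N => ?_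
    simp only [Function.comp]
    rw [← Real.rpow_mul (Nat.cast_nonneg _)]
    congr 1
    field_simp
  exact_mod_cast (summable_nat_add_iff 1).2 h2

lemma ae_finite_exceptional {Ω : Type*} [MeasurableSpace Ω] {P : Measure Ω}
    {bad : (ℤ × ℤ) × (ℤ × ℤ) → Set Ω} {δ : ℝ} (hδ : 0 < δ)
    (h : ∀ i ∈ admissible, P (bad i) ≤ ENNReal.ofReal
      (4 * Real.exp (-(3 / 2 * ((levelGap i.1 i.2 : ℝ) + 1) ^ δ)) / (cells i.1).card)) :
    ∀ᵐ ω ∂P, {i | i ∈ admissible ∧ ω ∈ bad i}.Finite := by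
  let u : ℕ → ℝ := fun N => Real.exp (-(1 / 2) * ((N : ℝ) + 1) ^ δ)
  have hu : Summable u := summable_exp_neg_rpow hδ
  have hu0 : 0 ≤ u := fun N => (Real.exp_pos _).le
  have hg : Summable fun a : ℕ => (1 / 2 : ℝ) ^ a :=
    summable_geometric_of_lt_one (by norm_num) (by norm_num)
  have hg0 : (0 : ℕ → ℝ) ≤ fun a : ℕ => (1 / 2 : ℝ) ^ a := fun a => by positivity
  have hW : Summable fun n : (ℕ × ℕ) × (ℕ × ℕ) =>
      16 * (((1 / 2 : ℝ) ^ n.1.1 * (1 / 2 : ℝ) ^ n.1.2) * (u n.2.1 * u n.2.2)) :=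
    ((hg.mul_of_nonneg hg hg0 hg0).mul_of_nonneg (hu.mul_of_nonneg hu hu0 hu0)
      (fun n => mul_nonneg (hg0 _) (hg0 _)) (fun n => mul_nonneg (hu0 _) (hu0 _))).mul_left 16
  let S : (ℕ × ℕ) × (ℕ × ℕ) → Set Ω := fun n => {ω | levelPair n ∈ admissible ∧ ω ∈ bad (levelPair n)}
  have hS : ∀ n, P (S n) ≤ ENNReal.ofReal
      (16 * (((1 / 2 : ℝ) ^ n.1.1 * (1 / 2 : ℝ) ^ n.1.2) * (u n.2.1 * u n.2.2))) := by
    intro n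
    by_cases hn : levelPair n ∈ admissible
    · refine (measure_mono fun ω hω => hω.2).trans ((h _ hn).trans (ENNReal.ofReal_le_ofReal ?_))
      rw [levelGap_levelPair, card_cells]
      -- Here a = k + 1; levels -1 and 0 both have one cell, so the shift costs a factor 2 per
      -- coordinate.
      have h1 : ∀ a : ℕ, (1 : ℝ) / 2 ^ ((a : ℤ) - 1).toNat ≤ 2 * (1 / 2) ^ a := by
        intro a
        rcases a with _ | a
        · have : (((0 : ℕ) : ℤ) - 1).toNat = 0 := rfl
          rw [this]
          norm_num
        · have : (((a + 1 : ℕ) : ℤ) - 1).toNat = a := by omega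
          rw [this, pow_succ, one_div_pow]
          linarith
      -- Monotonicity of x^δ splits the exponent between the two coordinates, so the majorant is a
      -- product of four convergent series.
      have h2 : Real.exp (-(3 / 2 * (((n.2.1 + n.2.2 : ℕ) : ℝ) + 1) ^ δ)) ≤ u n.2.1 * u n.2.2 := by
        rw [← Real.exp_add]
        apply Real.exp_le_exp.2
        push_cast
        have c1 : ((n.2.1 : ℝ) + 1) ^ δ ≤ ((n.2.1 : ℝ) + n.2.2 + 1) ^ δ := by
          have : (0 : ℝ) ≤ n.2.2 := by positivity
          gcongr
          linarith
        have c2 : ((n.2.2 : ℝ) + 1) ^ δ ≤ ((n.2.1 : ℝ) + n.2.2 + 1) ^ δ := by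
          have : (0 : ℝ) ≤ n.2.1 := by positivity
          gcongr
          linarith
        have c3 : 0 ≤ ((n.2.1 : ℝ) + n.2.2 + 1) ^ δ := by positivity
        linarith
      calc _ = 4 * ((1 / 2 ^ ((n.1.1 : ℤ) - 1).toNat) * (1 / 2 ^ ((n.1.2 : ℤ) - 1).toNat)) *
            Real.exp (-(3 / 2 * (((n.2.1 + n.2.2 : ℕ) : ℝ) + 1) ^ δ)) := by
            simp only [levelPair]
            push_cast
            rw [pow_add]
            field_simp
        _ ≤ 4 * ((2 * (1 / 2) ^ n.1.1) * (2 * (1 / 2) ^ n.1.2)) * (u n.2.1 * u n.2.2) := by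
            gcongr
            · exact h1 _
            · exact h1 _
        _ = _ := by ring
    · have : S n = ∅ := by ext ω; simp [S, hn]
      rw [this, measure_empty]
      exact zero_le
  have hsum : ∑' n, P (S n) ≠ ∞ := by
    refine ne_top_of_le_ne_top ?_ (ENNReal.tsum_le_tsum hS)
    exact hW.tsum_ofReal_ne_top
  filter_upwards [ae_finite_setOfPred_mem hsum] with ω hω
  refine (hω.image levelPair).subset fun i hi => ?_
  obtain ⟨n, rfl⟩ := exists_levelPair_eq hi.1
  exact ⟨n, hi, rfl⟩

/-! ### Almost sure finiteness of the norms for the sheet -/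

section Sheet

variable {Ω : Type*} [MeasurableSpace Ω] {P : Measure Ω} {B : (Fin 2 → ℝ≥0) → Ω → ℝ}

lemma ae_coeffNormA_lt_top [IsProbabilityMeasure P] (hB : IsBrownianSheet 2 B P) {ε : ℝ}
    (hε : 0 < ε) : ∀ᵐ ω ∂P, coeffNormA ε (faberCoeff (pathOnQ B ω)) < ∞ := by
  have hfin := ae_finite_exceptional (P := P) (δ := 2 * ε)
    (bad := fun i => {ω | ¬ ExpSqBound i.1 (expScale i.1 i.2)
      (((levelGap i.1 i.2 : ℝ) + 1) ^ (2 * ε)) (absMean (faberCoeff (pathOnQ B ω)) i.1 i.2)})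
    (by positivity) (by
      rintro ⟨k, j⟩ hi
      have hG := isGaussianProcess_faberCoeff hB j
      have hp : (1 : ℝ) ≤ ((levelGap k j : ℝ) + 1) ^ (2 * ε) :=
        Real.one_le_rpow (by linarith [(levelGap k j).cast_nonneg (α := ℝ)]) (by positivity)
      have key := measure_not_expSqBound_le (iIndepFun_faberCoeff hB j) hG.aemeasurable k j
        (φ := fun l v => ((2 : ℝ) ^ levelGap k j)⁻¹ * |∑ i, v i|)
        (fun l => by fun_prop) (θ := expScale k j) hp fun l => by
          have h := integral_exp_sq_absMean_le (iIndepFun_faberCoeff hB j)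
            hG.hasGaussianLaw_eval (integral_faberCoeff hB j) (variance_faberCoeff_le hB j)
            (card_children_le hi l)
          exact ⟨h.1, h.2.trans (Real.exp_le_exp.2 (by linarith))⟩
      have e : ∀ ω, absMean (faberCoeff (pathOnQ B ω)) k j = fun l =>
          ((2 : ℝ) ^ levelGap k j)⁻¹ * |∑ i : children k j l, faberCoeff (pathOnQ B ω) j i| :=
        fun ω => funext fun l => by
          rw [absMean, ← Finset.sum_coe_sort _ fun m => faberCoeff (pathOnQ B ω) j m]
      simp only [e]
      exact key)
  filter_upwards [hfin] with ω hω
  exact coeffNormA_lt_top hω hε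

lemma ae_coeffNormAtilde_lt_top [IsProbabilityMeasure P] (hB : IsBrownianSheet 2 B P) :
    ∀ᵐ ω ∂P, coeffNormAtilde (faberCoeff (pathOnQ B ω)) < ∞ := by
  have hfin := ae_finite_exceptional (P := P) (δ := 1)
    (bad := fun i => {ω | ¬ ExpSqBound i.1 (expScale i.1 i.2)
      (2 ^ levelGap i.1 i.2) (meanAbs (faberCoeff (pathOnQ B ω)) i.1 i.2)})
    one_pos (by
      rintro ⟨k, j⟩ hi
      have hG := isGaussianProcess_faberCoeff hB j
      have key := measure_not_expSqBound_le (iIndepFun_faberCoeff hB j) hG.aemeasurable k j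
        (φ := fun l v => ((2 : ℝ) ^ levelGap k j)⁻¹ * ∑ i, |v i|)
        (fun l => by fun_prop) (θ := expScale k j) (p := 2 ^ levelGap k j)
        (one_le_pow₀ one_le_two) fun l =>
          integral_exp_sq_meanAbs_le (iIndepFun_faberCoeff hB j)
            hG.hasGaussianLaw_eval (integral_faberCoeff hB j) (variance_faberCoeff_le hB j)
            (card_children_le hi l)
      have e : ∀ ω, meanAbs (faberCoeff (pathOnQ B ω)) k j = fun l =>
          ((2 : ℝ) ^ levelGap k j)⁻¹ * ∑ i : children k j l, |faberCoeff (pathOnQ B ω) j i| :=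
        fun ω => funext fun l => by
          rw [meanAbs, ← Finset.sum_coe_sort _ fun m => |faberCoeff (pathOnQ B ω) j m|]
      simp only [e]
      refine key.trans (ENNReal.ofReal_le_ofReal ?_)
      -- The choice p = 2^N exceeds N + 1, so the summability result with δ = 1 covers it.
      have : (levelGap k j : ℝ) + 1 ≤ 2 ^ levelGap k j := by
        exact_mod_cast Nat.lt_two_pow_self
      simp only [Real.rpow_one]
      gcongr)
  filter_upwards [hfin] with ω hω
  exact coeffNormAtilde_lt_top hω

lemma ae_continuousOn_pathOnQ (hB : IsBrownianSheet 2 B P) :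
    ∀ᵐ ω ∂P, ContinuousOn (pathOnQ B ω) Q := by
  filter_upwards [hB.continuous_paths] with ω hω
  have : Continuous fun x : ℝ × ℝ => (![x.1.toNNReal, x.2.toNNReal] : Fin 2 → ℝ≥0) := by
    refine continuous_pi fun i => ?_
    fin_cases i
    · exact continuous_real_toNNReal.comp continuous_fst
    · exact continuous_real_toNNReal.comp continuous_snd
  exact (hω.comp this).continuousOn

end Sheet

end SheetRegularity

end

theorem mainTheorem4 {Ω : Type*} [MeasurableSpace Ω] (P : Measure Ω) [IsProbabilityMeasure P]
    (B : (Fin 2 → ℝ≥0) → Ω → ℝ) (hB : SheetRegularity.IsBrownianSheet 2 B P)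
    (ε : ℝ) (hε : 0 < ε) :
    (∀ᵐ ω ∂P, SheetRegularity.pathOnQ B ω ∈ SheetRegularity.spaceA ε) ∧
      (∀ᵐ ω ∂P, SheetRegularity.pathOnQ B ω ∈ SheetRegularity.spaceAtilde) := by
  constructor
  · filter_upwards [SheetRegularity.ae_continuousOn_pathOnQ hB,
      SheetRegularity.ae_coeffNormA_lt_top hB hε] with ω hc hω
    exact ⟨hc, lt_of_le_of_lt
      (iInf₂_le _ (SheetRegularity.isFaberExpansion_faberCoeff hc)) hω⟩
  · filter_upwards [SheetRegularity.ae_continuousOn_pathOnQ hB,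
      SheetRegularity.ae_coeffNormAtilde_lt_top hB] with ω hc hω
    exact ⟨hc, lt_of_le_of_lt
      (iInf₂_le _ (SheetRegularity.isFaberExpansion_faberCoeff hc)) hω⟩
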